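/- Conventions. Let $X$ be a compact (connected) nonpositively curved cube complex with universal cover $\tilde X$, on which $\pi_1X$ acts by deck transformations. Combinatorial paths run along edges, the length of a path is its number of edges, and the combinatorial distance $d$ of two vertices is the minimal length of a combinatorial path between them; a combinatorial geodesic is a combinatorial path whose length is the distance of its endpoints. A subcomplex of $\tilde X$ is convex if it contains every combinatorial geodesic joining two of its vertices and every cube all of whose vertices it contains. A quasiline in $\tilde X$ is a pair $(\tilde Y,\varphi)$ of a nonempty convex subcomplex $\tilde Y\subset\tilde X$ and a nontrivial element $\varphi\in\pi_1X$ such that $\langle\varphi\rangle$ preserves $\tilde Y$ and acts cocompactly on it. A hyperplane $H$ of $\tilde Y$ is trivial if neither of its two halfspaces in $\tilde Y$ contains points arbitrarily far away from $H$. Proposition. Let $X$ be a compact nonpositively curved cube complex and let $(\tilde Y,\varphi)$ be a quasiline in $\tilde X$. Then there exist a real constant $B_0$ and an integer $n>0$, depending only on the quasiline $(\tilde Y,\varphi)$, such that for every real $B\ge B_0$ the following holds. Let $W\subset\tilde Y$ be a convex subcomplex and let $\gamma\subset W$ be a combinatorial geodesic that crosses no trivial hyperplane of $\tilde Y$. If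 $\gamma$ has length at least $3B$, then there exist a convex subcomplex $C\subset\tilde Y$ and an integer $l\ge 0$ such that 1. $\gamma$ contains a subsegment $\widehat\gamma$ of length greater than $B$ with $$\widehat\gamma\subset C\cup\varphi^{n}(C)\cup\cdots\cup\varphi^{nl}(C)\subset W;$$ 2. the pair $\left(\bigcup_{k\in\mathbb Z}\varphi^{nk}(C),\ \varphi^{n}\right)$ is a quasiline in $\tilde X$. -/

import Mathlib

universe u v

/-- An isometry of the unit cube `I^m` onto a face of `I^n`, recorded by its effect on vertices.
The maps `{0,1}^m → {0,1}^n` that arise in this way are exactly the ones that preserve the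
Hamming distance. -/
@[ext]
structure FaceMap (m n : ℕ) where
  toFun : (Fin m → Bool) → (Fin n → Bool)
  isometry : ∀ x y, hammingDist (toFun x) (toFun y) = hammingDist x y

namespace FaceMap

def id (n : ℕ) : FaceMap n n := ⟨fun x => x, fun _ _ => rfl⟩

def comp {l m n : ℕ} (g : FaceMap m n) (f : FaceMap l m) : FaceMap l n :=
  ⟨fun x => g.toFun (f.toFun x), fun x y => by rw [g.isometry, f.isometry]⟩

/-- The inclusion of the vertex `x` of `I^n`. -/
def point {n : ℕ} (x : Fin n → Bool) : FaceMap 0 n :=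
  ⟨fun _ => x, fun y z => by rw [Subsingleton.elim y z, hammingDist_self, hammingDist_self]⟩

/-- The inclusion of the edge of `I^n` that leaves the vertex `x` in the `i`-th direction. -/
def edge {n : ℕ} (x : Fin n → Bool) (i : Fin n) : FaceMap 1 n :=
  ⟨fun t => Function.update x i (xor (x i) (t 0)), fun s t => by
    by_cases h : s 0 = t 0
    · have : s = t := by ext j; rw [Subsingleton.elim j 0, h]
      subst this; simp
    · have h1 : hammingDist s t = 1 := by
        simp [hammingDist, h, Finset.filter_true_of_mem]
      rw [h1, hammingDist, Finset.card_eq_one]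
      refine ⟨i, ?_⟩
      ext j
      by_cases hj : j = i
      · subst hj; simpa using h
      · simp [hj]⟩

/-- The reflection of `I^1`. -/
def flip : FaceMap 1 1 :=
  ⟨fun t i => !(t i), fun s t => by simp [hammingDist]⟩

end FaceMap

/-- A cube complex, given by its characteristic maps. `Cube n` is the set of parametrized
`n`-cubes `I^n → K`, so that an `n`-cube of the complex is an orbit of the isometry group of `I^n`
on `Cube n`, and `face` restricts a parametrized cube to a (parametrized) subcube. No cube is
folded by a nontrivial isometry of itself. Subcubes of a cube may be glued to each other. -/
structure CubeComplex where
  Cube : ℕ → Type u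
  face : ∀ {m n : ℕ}, FaceMap m n → Cube n → Cube m
  face_id : ∀ {n : ℕ} (c : Cube n), face (FaceMap.id n) c = c
  face_comp : ∀ {l m n : ℕ} (g : FaceMap m n) (f : FaceMap l m) (c : Cube n),
    face (g.comp f) c = face f (face g c)
  free : ∀ {n : ℕ} (f : FaceMap n n) (c : Cube n), face f c = c → f = FaceMap.id n

namespace CubeComplex

variable (K : CubeComplex.{u})

/-- The corner `x` of a parametrized cube. -/
def vertex {n : ℕ} (c : K.Cube n) (x : Fin n → Bool) : K.Cube 0 := K.face (FaceMap.point x) c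

/-- The oriented edge of a parametrized cube that leaves the corner `x` in direction `i`. -/
def edge {n : ℕ} (c : K.Cube n) (x : Fin n → Bool) (i : Fin n) : K.Cube 1 :=
  K.face (FaceMap.edge x i) c

/-- The corner `(0, …, 0)`. -/
def origin {n : ℕ} (c : K.Cube n) : K.Cube 0 := K.vertex c (fun _ => false)

/-- The edges at the corner `(0, …, 0)`. -/
def originEdge {n : ℕ} (c : K.Cube n) (i : Fin n) : K.Cube 1 := K.edge c (fun _ => false) i

/-- The initial vertex of an oriented edge. -/
def src (e : K.Cube 1) : K.Cube 0 := K.vertex e (fun _ => false)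

/-- The terminal vertex of an oriented edge. -/
def tgt (e : K.Cube 1) : K.Cube 0 := K.vertex e (fun _ => true)

/-- The same edge with the opposite orientation. -/
def inv (e : K.Cube 1) : K.Cube 1 := K.face FaceMap.flip e

theorem src_inv (e : K.Cube 1) : K.src (K.inv e) = K.tgt e := by
  unfold src tgt inv vertex
  rw [← K.face_comp]
  rfl

theorem tgt_inv (e : K.Cube 1) : K.tgt (K.inv e) = K.src e := by
  unfold src tgt inv vertex
  rw [← K.face_comp]
  rfl

/-- Compactness: there are only finitely many cubes. -/
def IsCompact : Prop := Finite (Σ n, K.Cube n)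

/-- The link of every vertex is a flag simplicial complex. The vertices of the link of `v` are the
oriented edges starting at `v`, and its `(n-1)`-simplices are the corners at `v` of `n`-cubes. -/
structure IsNonpositivelyCurved : Prop where
  /-- every simplex of a link has distinct vertices -/
  edges_injective : ∀ {n : ℕ} (c : K.Cube n), Function.Injective (K.originEdge c)
  /-- a simplex of a link is determined by its vertices -/
  eq_of_edges : ∀ {n : ℕ} (c c' : K.Cube n), K.origin c = K.origin c' →
    (∀ i, K.originEdge c i = K.originEdge c' i) → c = c'
  /-- pairwise adjacent vertices of a link span a simplex -/
  flag : ∀ (v : K.Cube 0) {n : ℕ} (e : Fin n → K.Cube 1), (∀ i, K.src (e i) = v) →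
    Function.Injective e →
    (∀ i j, i ≠ j → ∃ s : K.Cube 2, K.originEdge s 0 = e i ∧ K.originEdge s 1 = e j) →
    ∃ c : K.Cube n, K.origin c = v ∧ ∀ i, K.originEdge c i = e i

/-- `K.IsEdgePath v l w`: the oriented edges in `l` form an edge path from `v` to `w`. -/
inductive IsEdgePath : K.Cube 0 → List (K.Cube 1) → K.Cube 0 → Prop
  | nil (v : K.Cube 0) : IsEdgePath v [] v
  | cons (e : K.Cube 1) (l : List (K.Cube 1)) (w : K.Cube 0) :
      IsEdgePath (K.tgt e) l w → IsEdgePath (K.src e) (e :: l) w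

/-- Elementary homotopies of edge paths: deleting a backtrack, and pushing a path across a
square. -/
inductive ElemHomotopy : List (K.Cube 1) → List (K.Cube 1) → Prop
  | backtrack (l₁ l₂ : List (K.Cube 1)) (e : K.Cube 1) :
      ElemHomotopy (l₁ ++ [e, K.inv e] ++ l₂) (l₁ ++ l₂)
  | square (l₁ l₂ : List (K.Cube 1)) (s : K.Cube 2) :
      ElemHomotopy
        (l₁ ++ [K.edge s ![false, false] 0, K.edge s ![true, false] 1] ++ l₂)
        (l₁ ++ [K.edge s ![false, false] 1, K.edge s ![false, true] 0] ++ l₂)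

/-- Homotopy of edge paths from `v` to `w`, relative to the endpoints. -/
def Homotopic (v w : K.Cube 0) : List (K.Cube 1) → List (K.Cube 1) → Prop :=
  Relation.EqvGen fun l l' => K.IsEdgePath v l w ∧ K.IsEdgePath v l' w ∧ K.ElemHomotopy l l'

def IsConnected : Prop := Nonempty (K.Cube 0) ∧ ∀ v w, ∃ l, K.IsEdgePath v l w

/-- `K` is connected with trivial (edge path) fundamental group. -/
def IsSimplyConnected : Prop :=
  K.IsConnected ∧ ∀ v l, K.IsEdgePath v l v → K.Homotopic v v l []

/-- The group of combinatorial automorphisms. -/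
def Aut : Subgroup (∀ n, Equiv.Perm (K.Cube n)) where
  carrier := {g | ∀ {m n : ℕ} (f : FaceMap m n) (c : K.Cube n), g m (K.face f c) = K.face f (g n c)}
  one_mem' := by intro m n f c; rfl
  mul_mem' := by
    intro g h hg hh m n f c
    simp only [Pi.mul_apply, Equiv.Perm.mul_apply]
    rw [hh, hg]
  inv_mem' := by
    intro g hg m n f c
    apply (g m).injective
    have h : ∀ (k : ℕ) (d : K.Cube k), g k ((g⁻¹) k d) = d := fun k d => (g k).apply_symm_apply d
    rw [h, hg, h]

/-- A combinatorial map: it sends `n`-cubes isometrically to `n`-cubes. -/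
structure Hom (K : CubeComplex.{u}) (L : CubeComplex.{v}) where
  toFun : ∀ n, K.Cube n → L.Cube n
  map_face : ∀ {m n : ℕ} (f : FaceMap m n) (c : K.Cube n),
    toFun m (K.face f c) = L.face f (toFun n c)

/-- Covering maps: surjective, and every cube at the image of a vertex `w` has exactly one lift
at `w`, so that the map is an isomorphism on the open stars of vertices. -/
def Hom.IsCovering {K : CubeComplex.{u}} {L : CubeComplex.{v}} (p : Hom K L) : Prop :=
  (∀ v : L.Cube 0, ∃ w : K.Cube 0, p.toFun 0 w = v) ∧
  ∀ (n : ℕ) (w : K.Cube 0) (c : L.Cube n), L.origin c = p.toFun 0 w →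
    ∃! c' : K.Cube n, K.origin c' = w ∧ p.toFun n c' = c

/-- `p` is a universal covering of its target. -/
def Hom.IsUniversalCover {K : CubeComplex.{u}} {L : CubeComplex.{v}} (p : Hom K L) : Prop :=
  p.IsCovering ∧ K.IsSimplyConnected

/-- The group of deck transformations. For a universal covering of `L` this is `π₁ L` with its
action on the universal cover. -/
def Hom.deck {K : CubeComplex.{u}} {L : CubeComplex.{v}} (p : Hom K L) : Subgroup K.Aut where
  carrier := {g | ∀ (n : ℕ) (c : K.Cube n), p.toFun n (g.1 n c) = p.toFun n c}
  one_mem' := by intro n c; rfl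
  mul_mem' := by
    intro g h hg hh n c
    have := hg n (h.1 n c)
    rw [hh] at this
    exact this
  inv_mem' := by
    intro g hg n c
    have h := hg n ((g.1 n).symm c)
    rw [Equiv.apply_symm_apply] at h
    exact h.symm

/-- The graph on the vertices in which the endpoints of each edge are adjacent. -/
def graph : SimpleGraph (K.Cube 0) where
  Adj v w := v ≠ w ∧ ∃ e : K.Cube 1, K.src e = v ∧ K.tgt e = w
  symm := ⟨by
    rintro v w ⟨hne, e, rfl, rfl⟩
    exact ⟨hne.symm, K.inv e, K.src_inv e, K.tgt_inv e⟩⟩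
  loopless := ⟨fun v h => h.1 rfl⟩

variable {K}

/-- Combinatorial geodesics: paths whose length is the combinatorial distance. -/
def IsGeodesic {a b : K.Cube 0} (γ : K.graph.Walk a b) : Prop := γ.length = K.graph.dist a b

variable (K) in
/-- A subcomplex: a set of cubes that is closed under passing to subcubes (and does not depend on
the parametrization). -/
@[ext]
structure Subcomplex where
  cells : ∀ n, Set (K.Cube n)
  face_mem : ∀ {m n : ℕ} (f : FaceMap m n) {c : K.Cube n}, c ∈ cells n → K.face f c ∈ cells m

namespace Subcomplex

instance : LE K.Subcomplex := ⟨fun Y Z => ∀ n, Y.cells n ⊆ Z.cells n⟩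

def iUnion {ι : Type*} (Y : ι → K.Subcomplex) : K.Subcomplex where
  cells n := ⋃ i, (Y i).cells n
  face_mem := by
    intro m n f c hc
    simp only [Set.mem_iUnion] at hc ⊢
    exact hc.imp fun i hi => (Y i).face_mem f hi

/-- The image `g(Y)` of a subcomplex under an automorphism. -/
def translate (g : K.Aut) (Y : K.Subcomplex) : K.Subcomplex where
  cells n := g.1 n '' Y.cells n
  face_mem := by
    rintro m n f _ ⟨c, hc, rfl⟩
    exact ⟨K.face f c, Y.face_mem f hc, g.2 f c⟩

/-- A path lies in `Y` if its vertices and edges do. -/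
def ContainsPath (Y : K.Subcomplex) {a b : K.Cube 0} (γ : K.graph.Walk a b) : Prop :=
  (∀ w ∈ γ.support, w ∈ Y.cells 0) ∧
  ∀ d ∈ γ.darts, ∀ e : K.Cube 1, K.src e = d.fst → K.tgt e = d.snd → e ∈ Y.cells 1

/-- Convex subcomplexes: they contain every combinatorial geodesic between two of their vertices,
and they are full, that is, they contain every cube all of whose vertices they contain. -/
structure IsConvex (Y : K.Subcomplex) : Prop where
  full : ∀ (n : ℕ) (c : K.Cube n), (∀ x, K.vertex c x ∈ Y.cells 0) → c ∈ Y.cells n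
  geodesic : ∀ a ∈ Y.cells 0, ∀ b ∈ Y.cells 0, ∀ γ : K.graph.Walk a b, IsGeodesic γ →
    Y.ContainsPath γ

/-- `G` preserves `Y`, and there are finitely many `G`-orbits of cubes of `Y`. -/
def ActsCocompactly (G : Subgroup K.Aut) (Y : K.Subcomplex) : Prop :=
  (∀ g ∈ G, Y.translate g = Y) ∧
  ∃ F : Set (Σ n, K.Cube n), F.Finite ∧
    ∀ (n : ℕ), ∀ c ∈ Y.cells n, ∃ g ∈ G, (⟨n, g.1 n c⟩ : Σ n, K.Cube n) ∈ F

/-- Two edges of `Y` are dual to the same midcube of some cube of `Y`. -/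
def SameMidcube (Y : K.Subcomplex) (e f : K.Cube 1) : Prop :=
  ∃ (n : ℕ) (c : K.Cube n) (i : Fin n) (x y : Fin n → Bool),
    c ∈ Y.cells n ∧ e = K.edge c x i ∧ f = K.edge c y i

/-- A hyperplane of `Y`, recorded as the set of the (oriented) edges of `Y` that it crosses: a
class of the equivalence relation generated by being dual to the same midcube of a cube of `Y`. -/
def IsHyperplane (Y : K.Subcomplex) (H : Set (K.Cube 1)) : Prop :=
  ∃ e ∈ Y.cells 1, H = {f | Relation.EqvGen Y.SameMidcube e f}

/-- The graph of `Y` with the edges crossed by `H` deleted, i.e. the `1`-skeleton of the complement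
in `Y` of the open carrier of `H`. -/
def cutGraph (Y : K.Subcomplex) (H : Set (K.Cube 1)) : SimpleGraph (K.Cube 0) :=
  SimpleGraph.fromRel fun v w => ∃ e ∈ Y.cells 1, e ∉ H ∧ K.src e = v ∧ K.tgt e = w

/-- The halfspaces of `H` in `Y`, recorded by their vertices: the connected components of the
complement in `Y` of the open carrier of `H`. -/
def IsHalfspace (Y : K.Subcomplex) (H : Set (K.Cube 1)) (U : Set (K.Cube 0)) : Prop :=
  ∃ v ∈ Y.cells 0, U = {w | (Y.cutGraph H).Reachable v w}

/-- `U` contains vertices arbitrarily far away from `H`. -/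
def IsDeep (H : Set (K.Cube 1)) (U : Set (K.Cube 0)) : Prop :=
  ∀ r : ℕ, ∃ v ∈ U, ∀ e ∈ H, r < K.graph.dist v (K.src e)

/-- A hyperplane of `Y` is trivial if all its halfspaces in `Y` are shallow. -/
def IsTrivialHyperplane (Y : K.Subcomplex) (H : Set (K.Cube 1)) : Prop :=
  Y.IsHyperplane H ∧ ∀ U, Y.IsHalfspace H U → ¬ IsDeep H U

end Subcomplex

/-- The path `γ` traverses an edge that is crossed by `H`. -/
def Crosses {a b : K.Cube 0} (γ : K.graph.Walk a b) (H : Set (K.Cube 1)) : Prop :=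
  ∃ d ∈ γ.darts, ∃ e ∈ H, K.src e = d.fst ∧ K.tgt e = d.snd

/-- Quasilines `(Y, φ)` in the universal cover `K` of `L`: a (nonempty) convex subcomplex `Y` and a
nontrivial deck transformation `φ` such that `⟨φ⟩` acts cocompactly on `Y`. -/
structure IsQuasiline {K : CubeComplex.{u}} {L : CubeComplex.{v}} (p : Hom K L)
    (Y : K.Subcomplex) (φ : K.Aut) : Prop where
  mem_deck : φ ∈ p.deck
  ne_one : φ ≠ 1
  nonempty : (Y.cells 0).Nonempty
  convex : Y.IsConvex
  cocompact : Y.ActsCocompactly (Subgroup.zpowers φ)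

end CubeComplex

/-!
Let `K` be the universal cover, and let `γ` be a long geodesic of `W ⊆ Y`.

**Halfspaces.** The first half of the file shows that the `1`-skeleton of `K` behaves like that of
a CAT(0) cube complex. Edge paths are considered up to pushing them across squares (`Shuffle`). By
the flag condition, two first edges of the same shuffle class span a square across which they are
exchanged (`Shuffle.exchange`); this is proved by induction on the length, and the induction step
is the completion of three squares at a vertex to a cube. It follows that prepending edges, with
cancellation, is a well-defined action of edges on shuffle classes of reduced paths, which
respects backtracks and squares (`actClass_inv`, `actClass_square`). So in the simply connected
complex `K` reduced paths with given endpoints form a single shuffle class (`Reduced.shuffle`),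
and they are the geodesics. There are two main consequences: distances from a vertex to the
endpoints of an edge differ by one (`dist_edge`), and the quadrangle condition holds
(`exists_sq`). They imply that the set `side e` of vertices closer to one endpoint of the edge `e`
is the same for parallel edges, that it is convex, that its boundary edges in `Y` form a
hyperplane of `Y` (`IsConvex.mem_hyp_of_src_mem`), and that a vertex outside of a convex
subcomplex is separated from it by a hyperplane (`IsConvex.exists_separating`).

**Quasilines.** If `φ` has finite order, then `Y` is finite and contains no long geodesics.
Otherwise `Y` has two ends. A hyperplane of `Y` is called periodic if a nontrivial power of `φ`
preserves its halfspaces. Periodic hyperplanes are coarsely dense in `Y`, so they are trivial, and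
a single power `φ ^ n` preserves all their halfspaces. The other hyperplanes are finite, of
uniformly bounded diameter (`IsLine.exists_hyp_diam_le`), and a deep halfspace of such a
hyperplane contains one end of `Y`. Therefore, if the hyperplane is close to a vertex in the
middle of a long geodesic, then the deep halfspace contains an endpoint of the geodesic
(`IsLine.exists_mem_side`).

**The subcomplex `C`.** Let `x` be the first vertex of the middle part of `γ`, and let the core
`Z` be the intersection of the halfspaces of `Y` that contain `x` and whose complement is shallow.
As `γ` does not cross trivial hyperplanes, and its middle part lies in no bounded halfspace, the
middle part is contained in `Z`, and `Z` is invariant under `φ ^ n`. A vertex of `Z` that is close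
to the middle part of `γ` lies in `W`: a hyperplane that separates it from `W` would have a deep
halfspace disjoint from `W`, which contains an endpoint of `γ` (`IsLine.exists_mem_of_mem_core`).
The convex hull of a large ball of `Z` is bounded (`IsLine.exists_hull_le`) and its translates
under `φ ^ n` cover `Z`. Those between the first and the last one that meet the middle part of `γ`
stay close to it, so they lie in `W`, and `C` is the first of them.
-/

/-! ### Squares and cubes -/

namespace FaceMap

/-- The inclusion of the square of `I^n` at the vertex `x` in the directions `i` and `j`. -/
def square {n : ℕ} (x : Fin n → Bool) {i j : Fin n} (h : i ≠ j) : FaceMap 2 n :=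
  ⟨fun t => Function.update (Function.update x i (xor (x i) (t 0))) j (xor (x j) (t 1)), by
    intro s t
    have hs : ∀ k : Fin n, Function.update (Function.update x i (xor (x i) (s 0))) j
        (xor (x j) (s 1)) k ≠ Function.update (Function.update x i (xor (x i) (t 0))) j
        (xor (x j) (t 1)) k ↔ (k = i ∧ s 0 ≠ t 0) ∨ (k = j ∧ s 1 ≠ t 1) := by
      intro k
      by_cases hj : k = j
      · subst hj
        simp [h.symm]
      · by_cases hi : k = i
        · subst hi
          simp [hj]
        · simp [hi, hj]
    unfold hammingDist
    simp only [hs]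
    rw [Finset.filter_or, Finset.card_union_of_disjoint]
    · have e1 : ∀ (k : Fin n) (p : Prop) [Decidable p],
          (Finset.univ.filter fun a => a = k ∧ p).card = if p then 1 else 0 := by
        intro k p _
        by_cases hp : p <;> simp [hp, Finset.filter_eq']
      rw [e1, e1, Finset.card_filter, Fin.sum_univ_two]
    · rw [Finset.disjoint_filter]
      rintro k - ⟨rfl, -⟩ ⟨hk, -⟩
      exact h hk⟩

end FaceMap

namespace CubeComplex

variable {K : CubeComplex.{u}}

theorem vertex_face {m n : ℕ} (f : FaceMap m n) (c : K.Cube n) (x : Fin m → Bool) :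
    K.vertex (K.face f c) x = K.vertex c (f.toFun x) := by
  unfold vertex
  rw [← K.face_comp]
  rfl

theorem edge_face {m n : ℕ} (f : FaceMap m n) (c : K.Cube n) (x : Fin m → Bool) (i : Fin m)
    (y : Fin n → Bool) (j : Fin n)
    (h : ∀ t, f.toFun (Function.update x i (xor (x i) t)) = Function.update y j (xor (y j) t)) :
    K.edge (K.face f c) x i = K.edge c y j := by
  unfold edge
  rw [← K.face_comp]
  congr 1
  apply FaceMap.ext
  funext t
  exact h (t 0)

theorem src_edge {n : ℕ} (c : K.Cube n) (x : Fin n → Bool) (i : Fin n) :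
    K.src (K.edge c x i) = K.vertex c x := by
  unfold src edge
  rw [vertex_face]
  simp [FaceMap.edge]

theorem tgt_edge {n : ℕ} (c : K.Cube n) (x : Fin n → Bool) (i : Fin n) :
    K.tgt (K.edge c x i) = K.vertex c (Function.update x i (!x i)) := by
  unfold tgt edge
  rw [vertex_face]
  simp [FaceMap.edge]

theorem inv_edge {n : ℕ} (c : K.Cube n) (x : Fin n → Bool) (i : Fin n) :
    K.inv (K.edge c x i) = K.edge c (Function.update x i (!x i)) i := by
  unfold inv edge
  rw [← K.face_comp]
  congr 1
  apply FaceMap.ext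
  funext t
  simp only [FaceMap.comp, FaceMap.edge, FaceMap.flip, Function.update_self, Function.update_idem]
  cases x i <;> cases t 0 <;> rfl

@[simp]
theorem inv_inv (e : K.Cube 1) : K.inv (K.inv e) = e := by
  unfold inv
  rw [← K.face_comp]
  conv_rhs => rw [← K.face_id e]
  congr 1
  apply FaceMap.ext
  funext t i
  simp [FaceMap.comp, FaceMap.flip, FaceMap.id]

theorem inv_injective : Function.Injective K.inv := fun e f h => by
  rw [← inv_inv e, h, inv_inv]

/-- `Sq e f e' f'`: the edge paths `e f` and `e' f'` are the two ways around a square. -/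
def Sq (e f e' f' : K.Cube 1) : Prop :=
  ∃ s : K.Cube 2, e = K.edge s ![false, false] 0 ∧ f = K.edge s ![true, false] 1 ∧
    e' = K.edge s ![false, false] 1 ∧ f' = K.edge s ![false, true] 0

theorem sq_of_cube {n : ℕ} (c : K.Cube n) (x : Fin n → Bool) {i j : Fin n} (h : i ≠ j) :
    Sq (K.edge c x i) (K.edge c (Function.update x i (!x i)) j)
      (K.edge c x j) (K.edge c (Function.update x j (!x j)) i) := by
  refine ⟨K.face (FaceMap.square x h) c, ?_, ?_, ?_, ?_⟩ <;> symm <;> apply edge_face <;>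
    intro t <;> funext k <;> by_cases hj : k = j <;> by_cases hi : k = i <;>
    simp_all [FaceMap.square, Function.update_apply]

theorem Sq.symm {e f e' f' : K.Cube 1} (h : Sq e f e' f') : Sq e' f' e f := by
  obtain ⟨s, rfl, rfl, rfl, rfl⟩ := h
  have h := sq_of_cube s ![false, false] (i := 1) (j := 0) (by decide)
  have h1 : Function.update ![false, false] 1 (!(![false, false] : Fin 2 → Bool) 1)
    = ![false, true] := by decide
  have h2 : Function.update ![false, false] 0 (!(![false, false] : Fin 2 → Bool) 0)
    = ![true, false] := by decide
  rwa [h1, h2] at h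

/-- The square seen from the next corner. -/
theorem Sq.rot {e f e' f' : K.Cube 1} (h : Sq e f e' f') : Sq (K.inv e) e' f (K.inv f') := by
  obtain ⟨s, rfl, rfl, rfl, rfl⟩ := h
  have h := sq_of_cube s ![true, false] (i := 0) (j := 1) (by decide)
  have h1 : Function.update ![true, false] 0 (!(![true, false] : Fin 2 → Bool) 0)
    = ![false, false] := by decide
  have h2 : Function.update ![true, false] 1 (!(![true, false] : Fin 2 → Bool) 1)
    = ![true, true] := by decide
  have h3 : Function.update ![false, false] 0 (!(![false, false] : Fin 2 → Bool) 0)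
    = ![true, false] := by decide
  have h4 : Function.update ![false, true] 0 (!(![false, true] : Fin 2 → Bool) 0)
    = ![true, true] := by decide
  rw [h1, h2] at h
  rwa [inv_edge, inv_edge, h3, h4]

/-- The square seen from the opposite corner. -/
theorem Sq.opp {e f e' f' : K.Cube 1} (h : Sq e f e' f') :
    Sq (K.inv f) (K.inv e) (K.inv f') (K.inv e') := by
  simpa using h.rot.symm.rot

theorem Sq.endpoints {e f e' f' : K.Cube 1} (h : Sq e f e' f') :
    K.src e = K.src e' ∧ K.tgt e = K.src f ∧ K.tgt e' = K.src f' ∧ K.tgt f = K.tgt f' := by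
  obtain ⟨s, rfl, rfl, rfl, rfl⟩ := h
  simp only [src_edge, tgt_edge]
  refine ⟨trivial, congrArg _ (by decide), congrArg _ (by decide), congrArg _ (by decide)⟩

theorem const_false_eq : (fun _ => false : Fin 2 → Bool) = ![false, false] := by decide

theorem Sq.ne (hK : K.IsNonpositivelyCurved) {e f e' f' : K.Cube 1} (h : Sq e f e' f') :
    e ≠ e' := by
  obtain ⟨s, rfl, rfl, rfl, rfl⟩ := h
  intro h
  have := @IsNonpositivelyCurved.edges_injective K hK 2 s 0 1
    (by simpa only [originEdge, const_false_eq] using h)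
  exact absurd this (by decide)

/-- A square is determined by its edges at a corner. -/
theorem Sq.unique (hK : K.IsNonpositivelyCurved) {e f e' f' f₁ f₁' : K.Cube 1}
    (h : Sq e f e' f') (h₁ : Sq e f₁ e' f₁') : f = f₁ ∧ f' = f₁' := by
  obtain ⟨s, rfl, rfl, rfl, rfl⟩ := h
  obtain ⟨t, h0, rfl, h1, rfl⟩ := h₁
  have : s = t := by
    apply hK.eq_of_edges
    · have := congrArg K.src h0
      rwa [src_edge, src_edge, ← const_false_eq] at this
    · rw [Fin.forall_fin_two, originEdge, originEdge, originEdge, originEdge, const_false_eq]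
      exact ⟨h0, h1⟩
  subst this
  exact ⟨rfl, rfl⟩

/-- Three pairwise adjacent squares at a vertex are the faces of a cube at that vertex. The
edges `g₁`, `g₂`, `g₃` end at the opposite corner of the cube. -/
theorem Sq.cube (hK : K.IsNonpositivelyCurved) {e₁ e₂ e₃ a₁₂ a₁₃ a₂₁ a₂₃ a₃₁ a₃₂ : K.Cube 1}
    (h12 : Sq e₁ a₁₂ e₂ a₂₁) (h13 : Sq e₁ a₁₃ e₃ a₃₁) (h23 : Sq e₂ a₂₃ e₃ a₃₂) :
    ∃ g₁ g₂ g₃, Sq a₁₂ g₃ a₁₃ g₂ ∧ Sq a₂₁ g₃ a₂₃ g₁ ∧ Sq a₃₁ g₂ a₃₂ g₁ := by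
  have n12 := h12.ne hK
  have n13 := h13.ne hK
  have n23 := h23.ne hK
  have key : ∀ {e f e' f' : K.Cube 1}, Sq e f e' f' →
      ∃ s : K.Cube 2, K.originEdge s 0 = e ∧ K.originEdge s 1 = e' := by
    rintro e f e' f' ⟨s, rfl, rfl, rfl, rfl⟩
    exact ⟨s, by rw [originEdge, const_false_eq], by rw [originEdge, const_false_eq]⟩
  obtain ⟨c, -, hc⟩ := hK.flag (K.src e₁) ![e₁, e₂, e₃]
    (by
      intro i
      fin_cases i
      · rfl
      · exact h12.endpoints.1.symm
      · exact h13.endpoints.1.symm)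
    (by
      intro i j hij
      fin_cases i <;> fin_cases j <;> simp_all)
    (by
      intro i j hij
      fin_cases i <;> fin_cases j
      · exact absurd rfl hij
      · exact key h12
      · exact key h13
      · exact key h12.symm
      · exact absurd rfl hij
      · exact key h23
      · exact key h13.symm
      · exact key h23.symm
      · exact absurd rfl hij)
  have falses : (fun _ => false : Fin 3 → Bool) = ![false, false, false] := by decide
  have c0 : K.edge c ![false, false, false] 0 = e₁ := by
    rw [← falses]; exact hc 0
  have c1 : K.edge c ![false, false, false] 1 = e₂ := by
    rw [← falses]; exact hc 1
  have c2 : K.edge c ![false, false, false] 2 = e₃ := by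
    rw [← falses]; exact hc 2
  have sq : ∀ (x : Fin 3 → Bool) (i j : Fin 3) (y z : Fin 3 → Bool), i ≠ j →
      Function.update x i (!x i) = y → Function.update x j (!x j) = z →
      Sq (K.edge c x i) (K.edge c y j) (K.edge c x j) (K.edge c z i) := by
    rintro x i j _ _ hij rfl rfl
    exact sq_of_cube c x hij
  have s12 := sq ![false, false, false] 0 1 ![true, false, false] ![false, true, false]
    (by decide) (by decide) (by decide)
  have s13 := sq ![false, false, false] 0 2 ![true, false, false] ![false, false, true]
    (by decide) (by decide) (by decide)
  have s23 := sq ![false, false, false] 1 2 ![false, true, false] ![false, false, true]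
    (by decide) (by decide) (by decide)
  rw [c0, c1] at s12
  rw [c0, c2] at s13
  rw [c1, c2] at s23
  obtain ⟨r1, r2⟩ := h12.unique hK s12
  obtain ⟨r3, r4⟩ := h13.unique hK s13
  obtain ⟨r5, r6⟩ := h23.unique hK s23
  rw [r1, r2, r3, r4, r5, r6]
  refine ⟨K.edge c ![false, true, true] 0, K.edge c ![true, false, true] 1,
    K.edge c ![true, true, false] 2, sq _ _ _ _ _ ?_ ?_ ?_, sq _ _ _ _ _ ?_ ?_ ?_,
    sq _ _ _ _ _ ?_ ?_ ?_⟩ <;> decide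

/-! ### Covering maps -/

section Covering

variable {L : CubeComplex.{v}} {p : Hom K L}

theorem Hom.map_vertex (p : Hom K L) {n : ℕ} (c : K.Cube n) (x : Fin n → Bool) :
    p.toFun 0 (K.vertex c x) = L.vertex (p.toFun n c) x := p.map_face _ _

theorem Hom.map_originEdge (p : Hom K L) {n : ℕ} (c : K.Cube n) (i : Fin n) :
    p.toFun 1 (K.originEdge c i) = L.originEdge (p.toFun n c) i := p.map_face _ _

theorem origin_originEdge {n : ℕ} (c : K.Cube n) (i : Fin n) :
    K.origin (K.originEdge c i) = K.origin c := by
  exact src_edge c _ i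

/-- Cubes at the same vertex with the same image under a covering map agree. -/
theorem Hom.IsCovering.eq_of_map_eq (hp : p.IsCovering) {n : ℕ} {c d : K.Cube n}
    (h0 : K.origin c = K.origin d) (h : p.toFun n c = p.toFun n d) : c = d :=
  (hp.2 n (K.origin d) (p.toFun n d) (p.map_vertex d _).symm).unique ⟨h0, h⟩ ⟨rfl, rfl⟩

theorem Hom.IsCovering.isNonpositivelyCurved (hp : p.IsCovering) (hL : L.IsNonpositivelyCurved) :
    K.IsNonpositivelyCurved where
  edges_injective := by
    intro n c i j h
    apply hL.edges_injective (p.toFun n c)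
    rw [← p.map_originEdge, ← p.map_originEdge, h]
  eq_of_edges := by
    intro n c c' h0 h
    apply hp.eq_of_map_eq h0
    apply hL.eq_of_edges
    · have := congrArg (p.toFun 0) h0
      rwa [origin, origin, p.map_vertex, p.map_vertex] at this
    · intro i
      rw [← p.map_originEdge, ← p.map_originEdge, h]
  flag := by
    intro v n e he hinj hsq
    obtain ⟨c, hc0, hc⟩ := hL.flag (p.toFun 0 v) (fun i => p.toFun 1 (e i))
      (by
        intro i
        rw [← he i]
        exact (p.map_vertex _ _).symm)
      (by
        intro i j hij
        exact hinj (hp.eq_of_map_eq ((he i).trans (he j).symm) hij))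
      (by
        intro i j hij
        obtain ⟨s, hs0, hs1⟩ := hsq i j hij
        exact ⟨p.toFun 2 s, by rw [← p.map_originEdge, hs0], by rw [← p.map_originEdge, hs1]⟩)
    obtain ⟨c', ⟨h0, h1⟩, -⟩ := hp.2 n v c hc0
    refine ⟨c', h0, fun i => hp.eq_of_map_eq ?_ ?_⟩
    · rw [origin_originEdge, h0]
      exact (he i).symm
    · rw [p.map_originEdge, h1, hc]

end Covering

/-! ### Edge paths up to pushing across squares -/

/-- Two lists of edges are shuffle equivalent if they differ by pushing paths across squares. -/
inductive Shuffle : List (K.Cube 1) → List (K.Cube 1) → Prop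
  | nil : Shuffle [] []
  | cons (e : K.Cube 1) {l l' : List (K.Cube 1)} : Shuffle l l' → Shuffle (e :: l) (e :: l')
  | swap {e f e' f' : K.Cube 1} {l l' : List (K.Cube 1)} : Sq e f e' f' → Shuffle l l' →
      Shuffle (e :: f :: l) (e' :: f' :: l')
  | trans {l l' l'' : List (K.Cube 1)} : Shuffle l l' → Shuffle l' l'' → Shuffle l l''

namespace Shuffle

theorem refl : ∀ l : List (K.Cube 1), Shuffle l l
  | [] => nil
  | e :: l => cons e (refl l)

theorem symm {l l' : List (K.Cube 1)} (h : Shuffle l l') : Shuffle l' l := by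
  induction h with
  | nil => exact nil
  | cons e _ ih => exact cons e ih
  | swap s _ ih => exact swap s.symm ih
  | trans _ _ ih₁ ih₂ => exact trans ih₂ ih₁

theorem length_eq {l l' : List (K.Cube 1)} (h : Shuffle l l') : l.length = l'.length := by
  induction h with
  | nil => rfl
  | cons e _ ih => simp [ih]
  | swap s _ ih => simp [ih]
  | trans _ _ ih₁ ih₂ => exact ih₁.trans ih₂

end Shuffle

theorem isEdgePath_nil_iff {v w : K.Cube 0} : K.IsEdgePath v [] w ↔ v = w := by
  constructor
  · rintro ⟨⟩
    rfl
  · rintro rfl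
    exact .nil v

theorem isEdgePath_cons_iff {v w : K.Cube 0} {e : K.Cube 1} {l : List (K.Cube 1)} :
    K.IsEdgePath v (e :: l) w ↔ K.src e = v ∧ K.IsEdgePath (K.tgt e) l w := by
  constructor
  · intro h
    cases h with
    | cons e l w h => exact ⟨rfl, h⟩
  · rintro ⟨rfl, h⟩
    exact .cons e l w h

theorem isEdgePath_append_iff {l l' : List (K.Cube 1)} {v w : K.Cube 0} :
    K.IsEdgePath v (l ++ l') w ↔ ∃ u, K.IsEdgePath v l u ∧ K.IsEdgePath u l' w := by
  induction l generalizing v with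
  | nil => simp [isEdgePath_nil_iff]
  | cons e l ih => simp [isEdgePath_cons_iff, ih, and_assoc]

theorem IsEdgePath.reverse {v w : K.Cube 0} {l : List (K.Cube 1)} (h : K.IsEdgePath v l w) :
    K.IsEdgePath w (l.map K.inv).reverse v := by
  induction h with
  | nil v => exact .nil v
  | cons e l w _ ih =>
    rw [List.map_cons, List.reverse_cons, isEdgePath_append_iff]
    refine ⟨_, ih, ?_⟩
    rw [isEdgePath_cons_iff, isEdgePath_nil_iff, K.src_inv, K.tgt_inv]
    exact ⟨rfl, rfl⟩

theorem Shuffle.isEdgePath {l l' : List (K.Cube 1)} (h : Shuffle l l') {v w : K.Cube 0}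
    (hl : K.IsEdgePath v l w) : K.IsEdgePath v l' w := by
  induction h generalizing v with
  | nil => exact hl
  | cons e _ ih =>
    rw [isEdgePath_cons_iff] at hl ⊢
    exact ⟨hl.1, ih hl.2⟩
  | swap s _ ih =>
    simp only [isEdgePath_cons_iff] at hl ⊢
    obtain ⟨h1, h2, h3, h4⟩ := s.endpoints
    exact ⟨h1.symm.trans hl.1, h3.symm, h4 ▸ ih hl.2.2⟩
  | trans _ _ ih₁ ih₂ => exact ih₂ (ih₁ hl)

/-- The first edges of two lists, together with the remaining lists, either agree or are
exchanged by pushing across one square. -/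
def Exchange (e : K.Cube 1) (l : List (K.Cube 1)) (f : K.Cube 1) (k : List (K.Cube 1)) : Prop :=
  (e = f ∧ Shuffle l k) ∨
    ∃ g h c, Sq e g f h ∧ Shuffle l (g :: c) ∧ Shuffle k (h :: c)

/-- The induction step for `Shuffle.exchange`. When both exchanges are proper, the three squares
at the end of the edge `f` are the faces of a cube at this vertex, and the exchange of `e` and `g`
is made across the opposite side of that cube. -/
theorem Exchange.trans (hK : K.IsNonpositivelyCurved) {e f g : K.Cube 1}
    {l₁ l₂ l₃ : List (K.Cube 1)}
    (ih : ∀ (a b : K.Cube 1) (k k' : List (K.Cube 1)), k.length < l₂.length →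
      Shuffle (a :: k) (b :: k') → Exchange a k b k')
    (h₁ : Exchange e l₁ f l₂) (h₂ : Exchange f l₂ g l₃) : Exchange e l₁ g l₃ := by
  rcases h₁ with ⟨rfl, h₁⟩ | ⟨a, b, c, s, hl₁, hl₂⟩
  · rcases h₂ with ⟨rfl, h₂⟩ | ⟨a, b, c, s, hl₁, hl₂⟩
    · exact .inl ⟨rfl, h₁.trans h₂⟩
    · exact .inr ⟨a, b, c, s, h₁.trans hl₁, hl₂⟩
  · rcases h₂ with ⟨rfl, h₂⟩ | ⟨a', b', c', s', hl₂', hl₃⟩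
    · exact .inr ⟨a, b, c, s, hl₁, h₂.symm.trans hl₂⟩
    · rcases ih b a' c c' (by simp [hl₂.length_eq]) (hl₂.symm.trans hl₂') with
        ⟨rfl, hc⟩ | ⟨d, d', k, t, hc, hc'⟩
      · have r := s.symm.rot
        have r' := s'.rot
        obtain ⟨rfl, h⟩ := r.unique hK r'
        rw [inv_injective h] at hl₁
        exact .inl ⟨rfl, hl₁.trans ((hc.cons _).trans hl₃.symm)⟩
      · obtain ⟨g₁, g₂, g₃, q1, q2, q3⟩ := Sq.cube hK s.symm.rot s'.rot t
        refine .inr ⟨g₃, g₂, K.inv g₁ :: k, q1, ?_, ?_⟩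
        · refine hl₁.trans ((hc.cons _).trans (.swap ?_ (.refl k)))
          simpa using q2.rot
        · refine hl₃.trans ((hc'.cons _).trans (.swap ?_ (.refl k)))
          simpa using q3.rot

/-- If shuffle equivalent paths start with the edges `e` and `f`, then either `e = f` and the
remaining paths are shuffle equivalent, or `e` and `f` span a square across which they can be
exchanged. -/
theorem Shuffle.exchange (hK : K.IsNonpositivelyCurved) {e f : K.Cube 1}
    {l k : List (K.Cube 1)} (h : Shuffle (e :: l) (f :: k)) : Exchange e l f k := by
  induction hn : l.length using Nat.strong_induction_on generalizing e f l k with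
  | _ n IH =>
    have key : ∀ {L L' : List (K.Cube 1)}, Shuffle L L' → ∀ e l f k, L = e :: l → L' = f :: k →
        l.length = n → Exchange e l f k := by
      intro L L' h
      induction h with
      | nil => intro e l f k h; exact absurd h (by simp)
      | cons e h _ =>
        rintro _ _ _ _ ⟨⟩ ⟨⟩ -
        exact .inl ⟨rfl, h⟩
      | swap s h _ =>
        rintro _ _ _ _ ⟨⟩ ⟨⟩ -
        exact .inr ⟨_, _, _, s, .refl _, h.symm.cons _⟩
      | @trans L₁ L₂ L₃ h₁ h₂ ih₁ ih₂ =>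
        rintro e l f k rfl rfl hl
        match L₂ with
        | [] => exact absurd h₁.length_eq (by simp)
        | g :: m =>
          have hm : m.length = n := by
            have := h₁.length_eq
            simp only [List.length_cons] at this
            omega
          refine Exchange.trans hK (fun a b k k' hk h => ?_) (ih₁ _ _ _ _ rfl rfl hl)
            (ih₂ _ _ _ _ rfl rfl hm)
          exact IH _ (hm ▸ hk) h rfl
    exact key h _ _ _ _ rfl rfl hn

theorem Shuffle.of_cons (hK : K.IsNonpositivelyCurved) {e : K.Cube 1} {l k : List (K.Cube 1)}
    (h : Shuffle (e :: l) (e :: k)) : Shuffle l k := by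
  rcases h.exchange hK with ⟨-, h⟩ | ⟨_, _, _, s, -, -⟩
  · exact h
  · exact absurd rfl (s.ne hK)

/-- A list of edges is reduced if no terminal part of it starts, up to shuffle equivalence, with
the inverse of the preceding edge. -/
def Reduced : List (K.Cube 1) → Prop
  | [] => True
  | e :: l => Reduced l ∧ ∀ k, ¬ Shuffle l (K.inv e :: k)

theorem Shuffle.reduced (hK : K.IsNonpositivelyCurved) {l l' : List (K.Cube 1)}
    (h : Shuffle l l') (hl : Reduced l) : Reduced l' := by
  induction h with
  | nil => exact hl
  | cons e h ih => exact ⟨ih hl.1, fun k hk => hl.2 k (h.trans hk)⟩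
  | trans _ _ ih₁ ih₂ => exact ih₂ (ih₁ hl)
  | @swap e f e' f' l l' s h ih =>
    obtain ⟨⟨h1, h2⟩, h3⟩ := hl
    refine ⟨⟨ih h1, fun k hk => ?_⟩, fun k hk => ?_⟩
    · exact h3 (e' :: k) (((h.trans hk).cons f).trans (.swap s.rot.symm (.refl k)))
    · have r := s.symm.rot
      rcases hk.exchange hK with ⟨h, -⟩ | ⟨g, b, c, t, hl', -⟩
      · exact r.ne hK h.symm
      · obtain ⟨rfl, -⟩ := t.unique hK r.symm
        exact h2 c (h.trans hl')

/-! ### Reduced edge paths are unique up to shuffles -/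

/-- `Act e l l'`: the reduced path `l'` is obtained from the reduced path `l` by prepending `e`,
and cancelling `e` against the first edge if `l` can be shuffled to start with the inverse of
`e`. -/
def Act (e : K.Cube 1) (l l' : List (K.Cube 1)) : Prop :=
  Shuffle l (K.inv e :: l') ∨ ((∀ k, ¬ Shuffle l (K.inv e :: k)) ∧ Shuffle (e :: l) l')

namespace Act

theorem exists_act (e : K.Cube 1) (l : List (K.Cube 1)) : ∃ l', Act e l l' := by
  by_cases h : ∃ k, Shuffle l (K.inv e :: k)
  · obtain ⟨k, hk⟩ := h
    exact ⟨k, .inl hk⟩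
  · exact ⟨e :: l, .inr ⟨fun k hk => h ⟨k, hk⟩, .refl _⟩⟩

theorem reduced (hK : K.IsNonpositivelyCurved) {e : K.Cube 1} {l l' : List (K.Cube 1)}
    (h : Act e l l') (hl : Reduced l) : Reduced l' := by
  rcases h with h | ⟨h₁, h⟩
  · exact (h.reduced hK hl).1
  · exact h.reduced hK ⟨hl, h₁⟩

theorem unique (hK : K.IsNonpositivelyCurved) {e : K.Cube 1} {l l' k k' : List (K.Cube 1)}
    (h : Act e l l') (hlk : Shuffle l k) (h' : Act e k k') : Shuffle l' k' := by
  rcases h with h | ⟨h₁, h⟩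
  · rcases h' with h' | ⟨h'₁, h'⟩
    · exact (h.symm.trans (hlk.trans h')).of_cons hK
    · exact absurd (hlk.symm.trans h) (h'₁ _)
  · rcases h' with h' | ⟨h'₁, h'⟩
    · exact absurd (hlk.trans h') (h₁ _)
    · exact h.symm.trans ((hlk.cons e).trans h')

theorem inv (hK : K.IsNonpositivelyCurved) {e : K.Cube 1} {l l' : List (K.Cube 1)}
    (hl : Reduced l) (h : Act e l l') : Act (K.inv e) l' l := by
  rcases h with h | ⟨h₁, h⟩
  · exact .inr ⟨(h.reduced hK hl).2, h.symm⟩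
  · exact .inl (by rw [inv_inv]; exact h.symm)

/-- Prepending the two paths around a square gives the same result. -/
theorem square (hK : K.IsNonpositivelyCurved) {e f e' f' : K.Cube 1} (s : Sq e f e' f')
    {l l₁ l₂ l₁' l₂' : List (K.Cube 1)} (h₁ : Act f l l₁) (h₂ : Act e l₁ l₂)
    (h₁' : Act f' l l₁') (h₂' : Act e' l₁' l₂') : Shuffle l₂ l₂' := by
  -- It is enough to find one pair of values of the action along `e' f'`.
  suffices h : ∃ k k', Act f' l k ∧ Act e' k k' ∧ Shuffle l₂ k' by
    obtain ⟨k, k', hk, hk', h⟩ := h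
    exact h.trans (hk'.unique hK (hk.unique hK (.refl l) h₁') h₂')
  rcases h₁ with h₁ | ⟨n₁, h₁⟩
  · rcases h₂ with h₂ | ⟨n₂, h₂⟩
    · exact ⟨_, l₂, .inl (h₁.trans ((h₂.cons _).trans (.swap s.opp (.refl _)))),
        .inl (.refl _), .refl _⟩
    · refine ⟨f' :: l, e :: l₁, .inr ⟨fun k hk => ?_, .refl _⟩, .inl ?_, h₂.symm⟩
      · rcases (h₁.symm.trans hk).exchange hK with ⟨h, -⟩ | ⟨g, b, c, t, h, -⟩
        · exact s.opp.ne hK h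
        · obtain ⟨rfl, -⟩ := t.unique hK s.opp
          exact n₂ c h
      · exact (h₁.cons _).trans (.swap s.symm.rot.symm (.refl _))
  · rcases h₂ with h₂ | ⟨n₂, h₂⟩
    · rcases (h₁.trans h₂).exchange hK with ⟨h, -⟩ | ⟨g, b, c, t, h, h'⟩
      · exact absurd h.symm (s.rot.ne hK)
      · obtain ⟨rfl, rfl⟩ := t.unique hK s.rot.symm
        refine ⟨c, b :: c, .inl h, .inr ⟨fun k hk => ?_, .refl _⟩, h'⟩
        exact n₁ _ (h.trans ((hk.cons _).trans (.swap s.symm.opp (.refl _))))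
    · refine ⟨f' :: l, e' :: f' :: l, .inr ⟨fun k hk => ?_, .refl _⟩,
        .inr ⟨fun k hk => ?_, .refl _⟩, h₂.symm.trans ((h₁.symm.cons e).trans
          (.swap s (.refl l)))⟩
      · exact n₂ _ (h₁.symm.trans ((hk.cons _).trans (.swap s.rot.symm (.refl _))))
      · rcases hk.exchange hK with ⟨h, -⟩ | ⟨g, b, c, t, h, h'⟩
        · exact s.symm.rot.ne hK h.symm
        · obtain ⟨rfl, rfl⟩ := t.unique hK s.symm.rot.symm
          exact n₁ _ h

theorem length (e : K.Cube 1) {l l' : List (K.Cube 1)} (h : Act e l l') :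
    l'.length + 1 = l.length ∨ l'.length = l.length + 1 := by
  rcases h with h | ⟨-, h⟩
  · have := h.length_eq
    simp only [List.length_cons] at this
    exact .inl this.symm
  · have := h.length_eq
    simp only [List.length_cons] at this
    exact .inr this.symm

theorem isEdgePath {e : K.Cube 1} {l l' : List (K.Cube 1)} (h : Act e l l') {w : K.Cube 0}
    (hl : K.IsEdgePath (K.tgt e) l w) : K.IsEdgePath (K.src e) l' w := by
  rcases h with h | ⟨-, h⟩
  · have := h.isEdgePath hl
    rw [isEdgePath_cons_iff, K.tgt_inv] at this
    exact this.2
  · exact h.isEdgePath (isEdgePath_cons_iff.2 ⟨rfl, hl⟩)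

end Act

/-- Reduced paths up to shuffle equivalence. -/
def reducedSetoid (K : CubeComplex.{u}) : Setoid {l : List (K.Cube 1) // Reduced l} where
  r l k := Shuffle l.1 k.1
  iseqv := ⟨fun l => .refl l.1, fun h => h.symm, fun h h' => h.trans h'⟩

/-- The action of `Act` on classes of reduced paths. -/
noncomputable def actClass (hK : K.IsNonpositivelyCurved) (e : K.Cube 1) :
    Quotient (reducedSetoid K) → Quotient (reducedSetoid K) :=
  Quotient.map (fun l => ⟨(Act.exists_act e l.1).choose,
      (Act.exists_act e l.1).choose_spec.reduced hK l.2⟩)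
    fun l k h => (Act.exists_act e l.1).choose_spec.unique hK h
      (Act.exists_act e k.1).choose_spec

theorem actClass_mk (hK : K.IsNonpositivelyCurved) {e : K.Cube 1} {l l' : List (K.Cube 1)}
    (hl : Reduced l) (h : Act e l l') : actClass hK e (Quotient.mk (reducedSetoid K) ⟨l, hl⟩) =
      Quotient.mk (reducedSetoid K) ⟨l', h.reduced hK hl⟩ :=
  Quotient.sound ((Act.exists_act e l).choose_spec.unique hK (.refl l) h)

theorem actClass_inv (hK : K.IsNonpositivelyCurved) (e : K.Cube 1)
    (m : Quotient (reducedSetoid K)) : actClass hK e (actClass hK (K.inv e) m) = m := by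
  induction m using Quotient.inductionOn with
  | _ l =>
    obtain ⟨l, hl⟩ := l
    obtain ⟨l', h⟩ := Act.exists_act (K.inv e) l
    have h' := h.inv hK hl
    rw [inv_inv] at h'
    rw [actClass_mk hK hl h, actClass_mk hK _ h']

theorem actClass_square (hK : K.IsNonpositivelyCurved) {e f e' f' : K.Cube 1}
    (s : Sq e f e' f') (m : Quotient (reducedSetoid K)) :
    actClass hK e (actClass hK f m) = actClass hK e' (actClass hK f' m) := by
  induction m using Quotient.inductionOn with
  | _ l =>
    obtain ⟨l, hl⟩ := l
    obtain ⟨l₁, h₁⟩ := Act.exists_act f l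
    obtain ⟨l₂, h₂⟩ := Act.exists_act e l₁
    obtain ⟨l₁', h₁'⟩ := Act.exists_act f' l
    obtain ⟨l₂', h₂'⟩ := Act.exists_act e' l₁'
    rw [actClass_mk hK hl h₁, actClass_mk hK _ h₂, actClass_mk hK hl h₁', actClass_mk hK _ h₂']
    exact Quotient.sound (Act.square hK s h₁ h₂ h₁' h₂')

/-- The action of edge paths is invariant under homotopy. -/
theorem foldr_actClass_eq (hK : K.IsNonpositivelyCurved) {v w : K.Cube 0}
    {l l' : List (K.Cube 1)} (h : K.Homotopic v w l l') (m : Quotient (reducedSetoid K)) :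
    l.foldr (actClass hK) m = l'.foldr (actClass hK) m := by
  induction h with
  | refl => rfl
  | symm _ _ _ ih => exact ih.symm
  | trans _ _ _ _ _ ih₁ ih₂ => exact ih₁.trans ih₂
  | rel l l' h =>
    cases h.2.2 with
    | backtrack l₁ l₂ e => simp [actClass_inv]
    | square l₁ l₂ s =>
      simp only [List.foldr_append, List.foldr_cons, List.foldr_nil]
      rw [actClass_square hK ⟨s, rfl, rfl, rfl, rfl⟩]

theorem foldr_actClass_reverse (hK : K.IsNonpositivelyCurved) (l : List (K.Cube 1))
    (m : Quotient (reducedSetoid K)) :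
    (l.map K.inv).reverse.foldr (actClass hK) (l.foldr (actClass hK) m) = m := by
  induction l generalizing m with
  | nil => rfl
  | cons e l ih =>
    have := actClass_inv hK (K.inv e) (l.foldr (actClass hK) m)
    rw [inv_inv] at this
    simp [this, ih]

theorem foldr_actClass_eq_of_isEdgePath (hK : K.IsNonpositivelyCurved)
    (hs : K.IsSimplyConnected) {v w : K.Cube 0} {l l' : List (K.Cube 1)}
    (h : K.IsEdgePath v l w) (h' : K.IsEdgePath v l' w) (m : Quotient (reducedSetoid K)) :
    l.foldr (actClass hK) m = l'.foldr (actClass hK) m := by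
  have := foldr_actClass_eq hK (hs.2 v _ (isEdgePath_append_iff.2 ⟨w, h, h'.reverse⟩))
    (l'.foldr (actClass hK) m)
  rwa [List.foldr_append, foldr_actClass_reverse] at this

theorem foldr_actClass_reduced (hK : K.IsNonpositivelyCurved) (l : List (K.Cube 1))
    (hl : Reduced l) : l.foldr (actClass hK) (Quotient.mk (reducedSetoid K) ⟨[], trivial⟩) =
      Quotient.mk (reducedSetoid K) ⟨l, hl⟩ := by
  induction l with
  | nil => rfl
  | cons e l ih => rw [List.foldr_cons, ih hl.1, actClass_mk hK hl.1 (.inr ⟨hl.2, .refl _⟩)]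

theorem Reduced.shuffle (hK : K.IsNonpositivelyCurved) (hs : K.IsSimplyConnected)
    {v w : K.Cube 0} {l l' : List (K.Cube 1)} (hl : Reduced l) (hl' : Reduced l')
    (h : K.IsEdgePath v l w) (h' : K.IsEdgePath v l' w) : Shuffle l l' := by
  have := foldr_actClass_eq_of_isEdgePath hK hs h h' (Quotient.mk _ ⟨[], trivial⟩)
  rw [foldr_actClass_reduced hK l hl, foldr_actClass_reduced hK l' hl'] at this
  exact Quotient.exact this

/-- Every edge path can be reduced without becoming longer, and becomes shorter if it is not
already reduced. -/
theorem exists_reduced (hK : K.IsNonpositivelyCurved) (hs : K.IsSimplyConnected)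
    {v w : K.Cube 0} (l : List (K.Cube 1)) (h : K.IsEdgePath v l w) :
    ∃ l', Reduced l' ∧ K.IsEdgePath v l' w ∧ l'.length ≤ l.length ∧
      (l'.length = l.length → Reduced l) := by
  induction h with
  | nil v => exact ⟨[], trivial, .nil v, le_rfl, fun _ => trivial⟩
  | cons e l w h ih =>
    obtain ⟨l', h1, h2, h3, h4⟩ := ih
    obtain ⟨l'', h'⟩ := Act.exists_act e l'
    refine ⟨l'', h'.reduced hK h1, h'.isEdgePath h2, ?_, ?_⟩
    · rcases h'.length with h | h <;> simp only [List.length_cons] <;> omega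
    · intro hlen
      rcases h' with h' | ⟨n, h'⟩
      · have := h'.length_eq
        simp only [List.length_cons] at this hlen
        omega
      · have := h'.length_eq
        simp only [List.length_cons] at this hlen
        have hl := h4 (by omega)
        exact ⟨hl, fun k hk => n k ((h1.shuffle hK hs hl h2 h).trans hk)⟩

/-! ### The combinatorial distance -/

theorem IsEdgePath.exists_walk {v w : K.Cube 0} {l : List (K.Cube 1)}
    (h : K.IsEdgePath v l w) : ∃ γ : K.graph.Walk v w, γ.length ≤ l.length := by
  induction h with
  | nil v => exact ⟨.nil, le_rfl⟩
  | cons e l w _ ih =>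
    obtain ⟨γ, hγ⟩ := ih
    by_cases h : K.src e = K.tgt e
    · exact ⟨γ.copy h.symm rfl, by simp; omega⟩
    · exact ⟨.cons ⟨h, e, rfl, rfl⟩ γ, Nat.succ_le_succ hγ⟩

theorem exists_isEdgePath_of_walk {v w : K.Cube 0} (γ : K.graph.Walk v w) :
    ∃ l, K.IsEdgePath v l w ∧ l.length = γ.length := by
  induction γ with
  | nil => exact ⟨[], .nil _, rfl⟩
  | cons h γ ih =>
    obtain ⟨l, hl, hl'⟩ := ih
    obtain ⟨-, e, rfl, rfl⟩ := h
    exact ⟨e :: l, .cons e l _ hl, congrArg Nat.succ hl'⟩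

theorem IsConnected.graph (h : K.IsConnected) : K.graph.Connected := by
  have := h.1
  refine ⟨fun v w => ?_⟩
  obtain ⟨l, hl⟩ := h.2 v w
  exact ⟨hl.exists_walk.choose⟩

theorem IsEdgePath.dist_le {v w : K.Cube 0} {l : List (K.Cube 1)}
    (h : K.IsEdgePath v l w) : K.graph.dist v w ≤ l.length := by
  obtain ⟨γ, hγ⟩ := h.exists_walk
  exact (SimpleGraph.dist_le γ).trans hγ

theorem exists_isEdgePath_length_eq_dist (hs : K.IsSimplyConnected) (v w : K.Cube 0) :
    ∃ l, K.IsEdgePath v l w ∧ l.length = K.graph.dist v w := by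
  obtain ⟨γ, hγ⟩ := hs.1.graph.exists_walk_length_eq_dist v w
  obtain ⟨l, hl, h⟩ := exists_isEdgePath_of_walk γ
  exact ⟨l, hl, h.trans hγ⟩

/-- Reduced paths are exactly the shortest ones. -/
theorem Reduced.length_eq_dist (hK : K.IsNonpositivelyCurved) (hs : K.IsSimplyConnected)
    {v w : K.Cube 0} {l : List (K.Cube 1)} (hl : Reduced l) (h : K.IsEdgePath v l w) :
    l.length = K.graph.dist v w := by
  refine le_antisymm ?_ h.dist_le
  obtain ⟨k, hk, hk'⟩ := exists_isEdgePath_length_eq_dist hs v w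
  obtain ⟨k', h1, h2, h3, -⟩ := exists_reduced hK hs k hk
  rw [← hk', (hl.shuffle hK hs h1 h h2).length_eq]
  exact h3

theorem IsEdgePath.reduced (hK : K.IsNonpositivelyCurved) (hs : K.IsSimplyConnected)
    {v w : K.Cube 0} {l : List (K.Cube 1)} (h : K.IsEdgePath v l w)
    (hl : l.length = K.graph.dist v w) : Reduced l := by
  obtain ⟨k', h1, h2, h3, h4⟩ := exists_reduced hK hs l h
  exact h4 (le_antisymm h3 (hl.le.trans h2.dist_le))

/-- The endpoints of an edge have different distance from every vertex. -/
theorem dist_edge (hK : K.IsNonpositivelyCurved) (hs : K.IsSimplyConnected) (e : K.Cube 1)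
    (v : K.Cube 0) : K.graph.dist v (K.tgt e) + 1 = K.graph.dist v (K.src e) ∨
      K.graph.dist v (K.tgt e) = K.graph.dist v (K.src e) + 1 := by
  rw [SimpleGraph.dist_comm, SimpleGraph.dist_comm (u := v)]
  obtain ⟨l, hl, hl'⟩ := exists_isEdgePath_length_eq_dist hs (K.tgt e) v
  obtain ⟨l', h⟩ := Act.exists_act e l
  have := (h.reduced hK (hl.reduced hK hs hl')).length_eq_dist hK hs (h.isEdgePath hl)
  rw [← this, ← hl']
  rcases h.length e with h | h <;> omega

theorem src_ne_tgt (hK : K.IsNonpositivelyCurved) (hs : K.IsSimplyConnected) (e : K.Cube 1) :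
    K.src e ≠ K.tgt e := by
  intro h
  have := dist_edge hK hs e (K.src e)
  rw [← h] at this
  omega

theorem adj_edge (hK : K.IsNonpositivelyCurved) (hs : K.IsSimplyConnected) (e : K.Cube 1) :
    K.graph.Adj (K.src e) (K.tgt e) :=
  ⟨src_ne_tgt hK hs e, e, rfl, rfl⟩

/-- The quadrangle condition: two edges at a vertex that lead towards `v` span a square whose
opposite corner is closer to `v`. -/
theorem exists_sq (hK : K.IsNonpositivelyCurved) (hs : K.IsSimplyConnected) {e f : K.Cube 1}
    (hef : e ≠ f) (h : K.src e = K.src f) {v : K.Cube 0}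
    (he : K.graph.dist v (K.tgt e) + 1 = K.graph.dist v (K.src e))
    (hf : K.graph.dist v (K.tgt f) + 1 = K.graph.dist v (K.src f)) :
    ∃ g k, Sq e g f k ∧ K.graph.dist v (K.tgt g) + 2 = K.graph.dist v (K.src e) := by
  have key : ∀ e, K.graph.dist v (K.tgt e) + 1 = K.graph.dist v (K.src e) →
      ∃ l, Reduced (e :: l) ∧ K.IsEdgePath (K.src e) (e :: l) v := by
    intro e he
    obtain ⟨l, hl, hl'⟩ := exists_isEdgePath_length_eq_dist hs (K.tgt e) v
    have : K.IsEdgePath (K.src e) (e :: l) v := .cons e l v hl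
    refine ⟨l, this.reduced hK hs ?_, this⟩
    rw [List.length_cons, hl', SimpleGraph.dist_comm, he, SimpleGraph.dist_comm]
  obtain ⟨l, hl, hl'⟩ := key e he
  obtain ⟨k, hk, hk'⟩ := key f hf
  rw [← h] at hk'
  rcases (hl.shuffle hK hs hk hl' hk').exchange hK with ⟨h, -⟩ | ⟨g, k, c, s, h1, -⟩
  · exact absurd h hef
  · refine ⟨g, k, s, ?_⟩
    rw [isEdgePath_cons_iff] at hl'
    have h2 := h1.isEdgePath hl'.2
    have h3 := (h1.reduced hK hl.1).length_eq_dist hK hs h2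
    have h4 := (h1.reduced hK hl.1).1.length_eq_dist hK hs (isEdgePath_cons_iff.1 h2).2
    rw [SimpleGraph.dist_comm, ← he, SimpleGraph.dist_comm (u := v), ← h3, ← h4,
      List.length_cons]

/-- An edge is determined by its endpoints. -/
theorem edge_ext (hK : K.IsNonpositivelyCurved) (hs : K.IsSimplyConnected) {e f : K.Cube 1}
    (h : K.src e = K.src f) (h' : K.tgt e = K.tgt f) : e = f := by
  by_contra hef
  have key : ∀ e : K.Cube 1, K.graph.dist (K.tgt e) (K.tgt e) + 1 =
      K.graph.dist (K.tgt e) (K.src e) := by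
    intro e
    have := dist_edge hK hs e (K.tgt e)
    rw [SimpleGraph.dist_self] at this ⊢
    omega
  have hf := key f
  rw [← h'] at hf
  obtain ⟨g, k, -, hd⟩ := exists_sq hK hs hef h (key e) (by rw [← h']; exact hf)
  have := key e
  rw [SimpleGraph.dist_self] at this
  omega

/-! ### Halfspaces and hyperplanes of convex subcomplexes -/

/-- Nonpositively curved and simply connected, i.e. CAT(0). -/
structure IsCATZero (K : CubeComplex.{u}) : Prop where
  npc : K.IsNonpositivelyCurved
  simplyConnected : K.IsSimplyConnected

/-- The vertices that are closer to the initial vertex of `e` than to its terminal vertex. -/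
def side (e : K.Cube 1) : Set (K.Cube 0) :=
  {v | K.graph.dist v (K.src e) < K.graph.dist v (K.tgt e)}

theorem IsCATZero.mem_side (hK : K.IsCATZero) {e : K.Cube 1} {v : K.Cube 0} :
    v ∈ side e ↔ K.graph.dist v (K.tgt e) = K.graph.dist v (K.src e) + 1 := by
  have := dist_edge hK.1 hK.2 e v
  unfold side
  rw [Set.mem_ofPred_eq]
  omega

theorem IsCATZero.notMem_side (hK : K.IsCATZero) {e : K.Cube 1} {v : K.Cube 0} :
    v ∉ side e ↔ K.graph.dist v (K.tgt e) + 1 = K.graph.dist v (K.src e) := by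
  have := dist_edge hK.1 hK.2 e v
  unfold side
  rw [Set.mem_ofPred_eq]
  omega

theorem IsCATZero.side_inv (hK : K.IsCATZero) (e : K.Cube 1) : side (K.inv e) = (side e)ᶜ := by
  ext v
  rw [Set.mem_compl_iff, hK.notMem_side, hK.mem_side, K.src_inv, K.tgt_inv, eq_comm]

theorem IsCATZero.src_mem_side (hK : K.IsCATZero) (e : K.Cube 1) : K.src e ∈ side e := by
  have := dist_edge hK.1 hK.2 e (K.src e)
  rw [hK.mem_side]
  rw [SimpleGraph.dist_self] at *
  omega

theorem IsCATZero.tgt_notMem_side (hK : K.IsCATZero) (e : K.Cube 1) : K.tgt e ∉ side e := by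
  have := dist_edge hK.1 hK.2 e (K.tgt e)
  rw [hK.notMem_side]
  rw [SimpleGraph.dist_self] at *
  omega

/-- Opposite edges of a square have the same sides. -/
theorem IsCATZero.side_eq_of_sq (hK : K.IsCATZero) {e g f k : K.Cube 1} (s : Sq e g f k) :
    side e = side k := by
  have key : ∀ {e g f k : K.Cube 1}, Sq e g f k → side e ⊆ side k := by
    intro e g f k s v hv
    by_contra hv'
    rw [hK.mem_side] at hv
    rw [hK.notMem_side] at hv'
    obtain ⟨h1, h2, h3, h4⟩ := s.endpoints
    have df := dist_edge hK.1 hK.2 f v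
    have dg := dist_edge hK.1 hK.2 g v
    rw [← h1] at df
    rw [← h2, h4] at dg
    rw [← h3] at hv'
    obtain ⟨g', k', t, ht⟩ := exists_sq hK.1 hK.2 (s.rot.ne hK.1) (by rw [K.src_inv, h2])
      (v := v) (by rw [K.src_inv, K.tgt_inv]; exact hv.symm) (by rw [← h2, h4]; omega)
    obtain ⟨rfl, -⟩ := t.unique hK.1 s.rot
    rw [K.src_inv] at ht
    omega
  refine (key s).antisymm ?_
  have := key s.rot
  rwa [hK.side_inv, hK.side_inv, Set.compl_subset_compl] at this

theorem IsCATZero.side_edge (hK : K.IsCATZero) {n : ℕ} (c : K.Cube n) (i : Fin n)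
    (x y : Fin n → Bool) : side (K.edge c y i) = side (K.edge c x i) ∨
      side (K.edge c y i) = (side (K.edge c x i))ᶜ := by
  have step : ∀ (x : Fin n → Bool) (j : Fin n) (b : Bool),
      side (K.edge c (Function.update x j b) i) = side (K.edge c x i) ∨
      side (K.edge c (Function.update x j b) i) = (side (K.edge c x i))ᶜ := by
    intro x j b
    by_cases hb : b = x j
    · left
      rw [hb, Function.update_eq_self]
    · obtain rfl : b = !x j := by cases b <;> cases h : x j <;> simp_all
      by_cases hj : i = j
      · subst hj
        right
        rw [← inv_edge, hK.side_inv]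
      · left
        exact (hK.side_eq_of_sq (sq_of_cube c x hj)).symm
  have : ∀ s : Finset (Fin n), side (K.edge c (s.piecewise y x) i) = side (K.edge c x i) ∨
      side (K.edge c (s.piecewise y x) i) = (side (K.edge c x i))ᶜ := by
    intro s
    induction s using Finset.induction_on with
    | empty => left; rw [Finset.piecewise_empty]
    | insert j s hj ih =>
      rw [Finset.piecewise_insert]
      rcases step (s.piecewise y x) j (y j) with h | h <;> rcases ih with h' | h' <;>
        rw [h, h'] <;> simp
  simpa using this Finset.univ

theorem IsCATZero.dist_triangle (hK : K.IsCATZero) (a b c : K.Cube 0) :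
    K.graph.dist a c ≤ K.graph.dist a b + K.graph.dist b c := hK.2.1.graph.dist_triangle

theorem IsCATZero.dist_eq_zero (hK : K.IsCATZero) {a b : K.Cube 0} :
    K.graph.dist a b = 0 ↔ a = b := hK.2.1.graph.dist_eq_zero_iff

theorem IsCATZero.dist_src_tgt (hK : K.IsCATZero) (e : K.Cube 1) :
    K.graph.dist (K.src e) (K.tgt e) = 1 :=
  SimpleGraph.dist_eq_one_iff_adj.2 (adj_edge hK.1 hK.2 e)

/-- The first edge of a geodesic from `a` to `b`. -/
theorem IsCATZero.exists_first_edge (hK : K.IsCATZero) {a b : K.Cube 0} (h : a ≠ b) :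
    ∃ e, K.src e = a ∧ K.graph.dist (K.tgt e) b + 1 = K.graph.dist a b := by
  obtain ⟨l, hl, hl'⟩ := exists_isEdgePath_length_eq_dist hK.2 a b
  match l with
  | [] => exact absurd (isEdgePath_nil_iff.1 hl) h
  | e :: l =>
    obtain ⟨rfl, hk⟩ := isEdgePath_cons_iff.1 hl
    refine ⟨e, rfl, ?_⟩
    have h1 := hk.dist_le
    have h2 := hK.dist_triangle (K.src e) (K.tgt e) b
    rw [hK.dist_src_tgt] at h2
    rw [List.length_cons] at hl'
    omega

namespace Subcomplex

variable {Y : K.Subcomplex}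

theorem vertex_mem (Y : K.Subcomplex) {n : ℕ} {c : K.Cube n} (hc : c ∈ Y.cells n)
    (x : Fin n → Bool) : K.vertex c x ∈ Y.cells 0 := Y.face_mem _ hc

theorem src_mem (Y : K.Subcomplex) {e : K.Cube 1} (he : e ∈ Y.cells 1) :
    K.src e ∈ Y.cells 0 := Y.face_mem _ he

theorem tgt_mem (Y : K.Subcomplex) {e : K.Cube 1} (he : e ∈ Y.cells 1) :
    K.tgt e ∈ Y.cells 0 := Y.face_mem _ he

theorem inv_mem (Y : K.Subcomplex) {e : K.Cube 1} (he : e ∈ Y.cells 1) :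
    K.inv e ∈ Y.cells 1 := Y.face_mem _ he

theorem forall_vertex_edge {e : K.Cube 1} {P : K.Cube 0 → Prop} (h : P (K.src e))
    (h' : P (K.tgt e)) (x : Fin 1 → Bool) : P (K.vertex e x) := by
  have : x = (fun _ => false) ∨ x = fun _ => true := by
    cases h : x 0
    · left; funext i; rw [Subsingleton.elim i 0, h]
    · right; funext i; rw [Subsingleton.elim i 0, h]
  rcases this with rfl | rfl
  · exact h
  · exact h'

theorem IsConvex.edge_mem (hY : Y.IsConvex) {e : K.Cube 1} (h : K.src e ∈ Y.cells 0)
    (h' : K.tgt e ∈ Y.cells 0) : e ∈ Y.cells 1 :=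
  hY.full 1 e (forall_vertex_edge h h')

/-- A convex subcomplex contains the interval between any two of its vertices. -/
theorem IsConvex.mem_of_dist (hY : Y.IsConvex) (hK : K.IsCATZero) {a b w : K.Cube 0}
    (ha : a ∈ Y.cells 0) (hb : b ∈ Y.cells 0)
    (h : K.graph.dist a w + K.graph.dist w b = K.graph.dist a b) : w ∈ Y.cells 0 := by
  obtain ⟨γ, hγ⟩ := hK.2.1.graph.exists_walk_length_eq_dist a w
  obtain ⟨δ, hδ⟩ := hK.2.1.graph.exists_walk_length_eq_dist w b
  refine (hY.geodesic a ha b hb (γ.append δ) ?_).1 w ?_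
  · rw [IsGeodesic, SimpleGraph.Walk.length_append, hγ, hδ, h]
  · rw [SimpleGraph.Walk.mem_support_append_iff]
    exact .inl γ.end_mem_support

theorem IsConvex.square_mem (hY : Y.IsConvex) {s : K.Cube 2}
    (h0 : K.edge s ![false, false] 0 ∈ Y.cells 1) (h1 : K.edge s ![false, true] 0 ∈ Y.cells 1) :
    s ∈ Y.cells 2 := by
  apply hY.full
  intro x
  have a := Y.src_mem h0
  have b := Y.tgt_mem h0
  have c := Y.src_mem h1
  have d := Y.tgt_mem h1
  rw [src_edge] at a c
  rw [tgt_edge] at b d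
  have : x = ![false, false] ∨ x = ![true, false] ∨ x = ![false, true] ∨ x = ![true, true] := by
    revert x; decide
  rcases this with rfl | rfl | rfl | rfl
  · exact a
  · convert b using 2; decide
  · exact c
  · convert d using 2; decide

/-- The hyperplane of `Y` that crosses the edge `e`. -/
def hyp (Y : K.Subcomplex) (e : K.Cube 1) : Set (K.Cube 1) :=
  {f | Relation.EqvGen Y.SameMidcube e f}

theorem SameMidcube.symm {e f : K.Cube 1} (h : Y.SameMidcube e f) : Y.SameMidcube f e := by
  obtain ⟨n, c, i, x, y, hc, rfl, rfl⟩ := h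
  exact ⟨n, c, i, y, x, hc, rfl, rfl⟩

theorem SameMidcube.mem {e f : K.Cube 1} (h : Y.SameMidcube e f) : f ∈ Y.cells 1 := by
  obtain ⟨n, c, i, x, y, hc, rfl, rfl⟩ := h
  exact Y.face_mem _ hc

/-- Edges of `Y` crossed by the hyperplane of `e` have the same sides as `e`, up to exchanging
the sides. -/
theorem side_eq_of_mem_hyp (hK : K.IsCATZero) {e f : K.Cube 1} (h : f ∈ Y.hyp e) :
    side f = side e ∨ side f = (side e)ᶜ := by
  induction h with
  | rel e f h =>
    obtain ⟨n, c, i, x, y, hc, rfl, rfl⟩ := h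
    exact hK.side_edge c i x y
  | refl e => exact .inl rfl
  | symm e f _ ih => rcases ih with h | h <;> simp [h]
  | trans e f g _ _ ih₁ ih₂ =>
    rcases ih₁ with h | h <;> rcases ih₂ with h' | h' <;> simp [h, h']

theorem mem_of_mem_hyp {e f : K.Cube 1} (he : e ∈ Y.cells 1) (h : f ∈ Y.hyp e) :
    f ∈ Y.cells 1 := by
  have : ∀ {e f}, Relation.EqvGen Y.SameMidcube e f → (e ∈ Y.cells 1 ↔ f ∈ Y.cells 1) := by
    intro e f h
    induction h with
    | rel e f h => exact ⟨fun _ => h.mem, fun _ => h.symm.mem⟩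
    | refl e => rfl
    | symm e f _ ih => exact ih.symm
    | trans e f g _ _ ih₁ ih₂ => exact ih₁.trans ih₂
  exact (this h).1 he

/-- An edge that leads from one side of `e` to the other is joined to `e` by a ladder of squares
along a geodesic. -/
theorem IsConvex.mem_hyp_of_src_mem (hY : Y.IsConvex) (hK : K.IsCATZero) {e f : K.Cube 1}
    (he : e ∈ Y.cells 1) (hf : f ∈ Y.cells 1) (h : K.src f ∈ side e) (h' : K.tgt f ∉ side e) :
    f ∈ Y.hyp e ∧ side f = side e := by
  induction hn : K.graph.dist (K.src e) (K.src f) generalizing f with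
  | zero =>
    have h1 : K.src e = K.src f := hK.dist_eq_zero.1 hn
    have h2 : K.tgt e = K.tgt f := by
      rw [hK.notMem_side] at h'
      have := hK.dist_src_tgt f
      rw [← h1, SimpleGraph.dist_comm] at this
      rw [eq_comm, ← hK.dist_eq_zero]
      omega
    obtain rfl := edge_ext hK.1 hK.2 h1 h2
    exact ⟨.refl _, rfl⟩
  | succ n ih =>
    have hne : K.src f ≠ K.src e := by
      intro h
      rw [h, SimpleGraph.dist_self] at hn
      omega
    obtain ⟨g, hg, hgd⟩ := hK.exists_first_edge hne
    rw [hK.mem_side] at h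
    rw [hK.notMem_side] at h'
    have d1 := dist_edge hK.1 hK.2 f (K.src e)
    have d2 := dist_edge hK.1 hK.2 f (K.tgt e)
    have d3 := dist_edge hK.1 hK.2 g (K.tgt e)
    have d4 := hK.dist_triangle (K.tgt e) (K.src e) (K.tgt g)
    rw [SimpleGraph.dist_comm (u := K.tgt e) (v := K.src e), hK.dist_src_tgt] at d4
    have c1 := SimpleGraph.dist_comm (G := K.graph) (u := K.src f) (v := K.src e)
    have c2 := SimpleGraph.dist_comm (G := K.graph) (u := K.src f) (v := K.tgt e)
    have c3 := SimpleGraph.dist_comm (G := K.graph) (u := K.tgt f) (v := K.src e)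
    have c4 := SimpleGraph.dist_comm (G := K.graph) (u := K.tgt f) (v := K.tgt e)
    have c5 := SimpleGraph.dist_comm (G := K.graph) (u := K.tgt g) (v := K.src e)
    rw [hg] at d3
    have hgf : g ≠ f := by
      rintro rfl
      omega
    obtain ⟨f', k, s, hd⟩ := exists_sq hK.1 hK.2 hgf hg (v := K.tgt e) (by rw [hg]; omega)
      (by omega)
    obtain ⟨s1, s2, s3, s4⟩ := s.endpoints
    -- `f'` is the edge opposite to `f`.
    have hff' : side f' = side f := (hK.side_eq_of_sq s.symm).symm
    have d5 := dist_edge hK.1 hK.2 f' (K.src e)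
    have d6 := dist_edge hK.1 hK.2 k (K.src e)
    have d7 := hK.dist_triangle (K.src e) (K.tgt e) (K.tgt f')
    rw [hK.dist_src_tgt] at d7
    rw [← s3, ← s4] at d6
    rw [hg] at hd
    have hgY : K.tgt g ∈ Y.cells 0 := hY.mem_of_dist hK (Y.src_mem he) (Y.src_mem hf) (by
      rw [SimpleGraph.dist_comm (u := K.tgt g) (v := K.src f), ← hg, hK.dist_src_tgt, hg]
      omega)
    have hfY : K.tgt f' ∈ Y.cells 0 := hY.mem_of_dist hK (Y.tgt_mem he) (Y.tgt_mem hf) (by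
      rw [s4, s3, SimpleGraph.dist_comm (u := K.tgt k) (v := K.src k), hK.dist_src_tgt, ← s3,
        ← s4]
      omega)
    have hfY' : f' ∈ Y.cells 1 := hY.edge_mem (s2 ▸ hgY) hfY
    obtain ⟨h1, h2⟩ := ih hfY'
      (by
        rw [hK.mem_side, ← s2, SimpleGraph.dist_comm, SimpleGraph.dist_comm (u := K.tgt g)]
        omega)
      (by
        rw [hK.notMem_side, SimpleGraph.dist_comm, SimpleGraph.dist_comm (u := K.tgt f')]
        omega)
      (by rw [← s2]; omega)
    refine ⟨.trans _ _ _ h1 (.rel _ _ ?_), hff'.symm.trans h2⟩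
    obtain ⟨q, rfl, rfl, rfl, rfl⟩ := s.symm
    exact ⟨2, q, 0, _, _, hY.square_mem hf hfY', rfl, rfl⟩

end Subcomplex

namespace Subcomplex

variable {Y : K.Subcomplex}

/-- A geodesic that leaves a set of vertices crosses an edge that leaves it. -/
theorem IsConvex.exists_edge_of_mem_of_notMem (hY : Y.IsConvex) (hK : K.IsCATZero)
    {S : Set (K.Cube 0)} {x y : K.Cube 0} (hx : x ∈ Y.cells 0) (hy : y ∈ Y.cells 0)
    (hxS : x ∈ S) (hyS : y ∉ S) : ∃ f ∈ Y.cells 1, K.src f ∈ S ∧ K.tgt f ∉ S ∧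
      K.graph.dist x (K.src f) + 1 + K.graph.dist (K.tgt f) y = K.graph.dist x y := by
  induction hn : K.graph.dist x y generalizing x with
  | zero => exact absurd (hK.dist_eq_zero.1 hn ▸ hxS) hyS
  | succ n ih =>
    obtain ⟨f, rfl, hf⟩ := hK.exists_first_edge (a := x) (b := y)
      (by rintro rfl; exact hyS hxS)
    have hfY : K.tgt f ∈ Y.cells 0 := hY.mem_of_dist hK hx hy (by
      rw [hK.dist_src_tgt]
      omega)
    by_cases h : K.tgt f ∈ S
    · obtain ⟨g, hg, h1, h2, h3⟩ := ih hfY h (by omega)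
      refine ⟨g, hg, h1, h2, ?_⟩
      have t1 := hK.dist_triangle (K.src f) (K.tgt f) (K.src g)
      have t2 := hK.dist_triangle (K.src f) (K.src g) y
      have t3 := hK.dist_triangle (K.src g) (K.tgt g) y
      rw [hK.dist_src_tgt] at t1 t3
      omega
    · refine ⟨f, hY.edge_mem hx hfY, hxS, h, ?_⟩
      rw [SimpleGraph.dist_self]
      omega

theorem inv_mem_hyp {e : K.Cube 1} (he : e ∈ Y.cells 1) : K.inv e ∈ Y.hyp e := by
  refine .rel _ _ ⟨1, e, 0, fun _ => false, fun _ => true, he, ?_, ?_⟩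
  · conv_lhs => rw [← K.face_id e]
    unfold edge
    congr 1
    apply FaceMap.ext
    funext t i
    simp [FaceMap.id, FaceMap.edge, Subsingleton.elim i 0]
  · unfold edge inv
    congr 1
    apply FaceMap.ext
    funext t i
    simp [FaceMap.flip, FaceMap.edge, Subsingleton.elim i 0]

theorem hyp_inv {e : K.Cube 1} (he : e ∈ Y.cells 1) : Y.hyp (K.inv e) = Y.hyp e := by
  have h : Relation.EqvGen Y.SameMidcube e (K.inv e) := inv_mem_hyp he
  ext f
  exact ⟨fun hf => .trans _ _ _ h hf, fun hf => .trans _ _ _ (.symm _ _ h) hf⟩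

/-- The edges of `Y` that join the two sides of `e` are crossed by the hyperplane of `e`. -/
theorem IsConvex.mem_hyp (hY : Y.IsConvex) (hK : K.IsCATZero) {e f : K.Cube 1}
    (he : e ∈ Y.cells 1) (hf : f ∈ Y.cells 1) (h : ¬ (K.src f ∈ side e ↔ K.tgt f ∈ side e)) :
    f ∈ Y.hyp e := by
  by_cases h1 : K.src f ∈ side e
  · exact (hY.mem_hyp_of_src_mem hK he hf h1 (by tauto)).1
  · rw [← hyp_inv he]
    refine (hY.mem_hyp_of_src_mem hK (Y.inv_mem he) hf ?_ ?_).1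
    · rwa [hK.side_inv]
    · rw [hK.side_inv, Set.notMem_compl_iff]
      tauto

/-- The sides of an edge of `Y` are convex in `Y`. -/
theorem IsConvex.mem_side_of_dist (hY : Y.IsConvex) (hK : K.IsCATZero) {e : K.Cube 1}
    (he : e ∈ Y.cells 1) {a b w : K.Cube 0} (ha : a ∈ Y.cells 0) (hb : b ∈ Y.cells 0)
    (ha' : a ∈ side e) (hb' : b ∈ side e)
    (h : K.graph.dist a w + K.graph.dist w b = K.graph.dist a b) : w ∈ side e := by
  by_contra hw
  have hwY := hY.mem_of_dist hK ha hb h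
  obtain ⟨f, hf, f1, f2, f3⟩ := hY.exists_edge_of_mem_of_notMem hK ha hwY ha' hw
  have := (hY.mem_hyp_of_src_mem hK he hf f1 f2).2
  rw [← this, hK.mem_side] at hb'
  have t1 := hK.dist_triangle a (K.src f) b
  have t2 := hK.dist_triangle (K.tgt f) w b
  rw [SimpleGraph.dist_comm, SimpleGraph.dist_comm (u := b)] at hb'
  omega

theorem IsConvex.notMem_side_of_dist (hY : Y.IsConvex) (hK : K.IsCATZero) {e : K.Cube 1}
    (he : e ∈ Y.cells 1) {a b w : K.Cube 0} (ha : a ∈ Y.cells 0) (hb : b ∈ Y.cells 0)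
    (ha' : a ∉ side e) (hb' : b ∉ side e)
    (h : K.graph.dist a w + K.graph.dist w b = K.graph.dist a b) : w ∉ side e := by
  rw [← Set.mem_compl_iff, ← hK.side_inv] at *
  exact hY.mem_side_of_dist hK (Y.inv_mem he) ha hb ha' hb' h

/-- A vertex outside of a convex subcomplex is separated from it by a hyperplane, which crosses
the first edge of a shortest path from the subcomplex to the vertex. -/
theorem IsConvex.exists_separating (hY : Y.IsConvex) (hK : K.IsCATZero) {W : K.Subcomplex}
    (hW : W.IsConvex) (hWY : W ≤ Y) (hne : (W.cells 0).Nonempty) {z : K.Cube 0}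
    (hz : z ∈ Y.cells 0) (hzW : z ∉ W.cells 0) :
    ∃ e ∈ Y.cells 1, z ∈ side e ∧ ∀ w ∈ W.cells 0, w ∉ side e := by
  obtain ⟨w, hw, hmin⟩ := WellFounded.has_min (measure fun w => K.graph.dist z w).wf _ hne
  obtain ⟨e, rfl, he⟩ := hK.exists_first_edge (a := w) (b := z)
    (by rintro rfl; exact hzW hw)
  have hlt : K.graph.dist z (K.tgt e) < K.graph.dist z (K.src e) := by
    rw [SimpleGraph.dist_comm, SimpleGraph.dist_comm (u := z)]
    omega
  have heY : K.tgt e ∈ Y.cells 0 := hY.mem_of_dist hK (hWY 0 hw) hz (by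
    rw [hK.dist_src_tgt]
    omega)
  refine ⟨K.inv e, Y.inv_mem (hY.edge_mem (hWY 0 hw) heY), ?_, ?_⟩
  · rw [side, Set.mem_ofPred_eq, K.src_inv, K.tgt_inv]
    exact hlt
  · intro u hu hu'
    rw [hK.mem_side, K.src_inv, K.tgt_inv] at hu'
    refine hmin _ (hW.mem_of_dist hK hu hw (w := K.tgt e) ?_) hlt
    rw [SimpleGraph.dist_comm (v := K.src e), hK.dist_src_tgt, hu']

/-- The part of `Y` on the side of the initial vertex of `e`. -/
def half (Y : K.Subcomplex) (e : K.Cube 1) : Set (K.Cube 0) := Y.cells 0 ∩ side e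

/-- The halfspace of `Y` on the side of the initial vertex of `e` is deep. -/
def Deep (Y : K.Subcomplex) (e : K.Cube 1) : Prop := IsDeep (Y.hyp e) (Y.half e)

/-- If both sides of `e` in `Y` are shallow, then `e` is dual to a trivial hyperplane, since every
component of the complement of the hyperplane lies on one side of `e`. -/
theorem IsConvex.isTrivialHyperplane (hY : Y.IsConvex) (hK : K.IsCATZero) {e : K.Cube 1}
    (he : e ∈ Y.cells 1) (h : ¬ Y.Deep e) (h' : ¬ Y.Deep (K.inv e)) :
    Y.IsTrivialHyperplane (Y.hyp e) := by
  refine ⟨⟨e, he, rfl⟩, ?_⟩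
  rintro U ⟨v, hv, rfl⟩ hU
  have hsame : ∀ w, (Y.cutGraph (Y.hyp e)).Reachable v w →
      w ∈ Y.cells 0 ∧ (v ∈ side e ↔ w ∈ side e) := by
    rintro w ⟨γ⟩
    induction γ with
    | nil => exact ⟨hv, Iff.rfl⟩
    | @cons v u w hadj γ ih =>
      have : u ∈ Y.cells 0 ∧ (v ∈ side e ↔ u ∈ side e) := by
        rw [cutGraph, SimpleGraph.fromRel_adj] at hadj
        rcases hadj.2 with ⟨f, hf, hfe, rfl, rfl⟩ | ⟨f, hf, hfe, rfl, rfl⟩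
        · exact ⟨Y.tgt_mem hf, by_contra fun h => hfe (hY.mem_hyp hK he hf h)⟩
        · exact ⟨Y.src_mem hf, by_contra fun h => hfe (hY.mem_hyp hK he hf fun h' => h h'.symm)⟩
      obtain ⟨h1, h2⟩ := ih this.1 (fun r => by
        obtain ⟨x, hx, hx'⟩ := hU r
        refine ⟨x, ?_, hx'⟩
        exact SimpleGraph.Reachable.trans ⟨.cons hadj.symm .nil⟩ hx)
      exact ⟨h1, this.2.trans h2⟩
  by_cases hve : v ∈ side e
  · exact h fun r => (hU r).imp fun x hx =>
      ⟨⟨(hsame x hx.1).1, (hsame x hx.1).2.1 hve⟩, hx.2⟩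
  · refine h' fun r => (hU r).imp fun x hx => ⟨⟨(hsame x hx.1).1, ?_⟩, ?_⟩
    · rw [hK.side_inv]
      exact fun hx' => hve ((hsame x hx.1).2.2 hx')
    · rw [hyp_inv he]
      exact hx.2

theorem vertex_zero (c : K.Cube 0) (x : Fin 0 → Bool) : K.vertex c x = c := by
  unfold vertex
  conv_rhs => rw [← K.face_id c]
  congr 1
  apply FaceMap.ext
  funext t
  exact Subsingleton.elim _ _

/-- The full subcomplex on a set of vertices. -/
def span (K : CubeComplex.{u}) (S : Set (K.Cube 0)) : K.Subcomplex where
  cells n := {c | ∀ x, K.vertex c x ∈ S}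
  face_mem := by
    intro m n f c hc x
    rw [vertex_face]
    exact hc _

theorem mem_span_zero {S : Set (K.Cube 0)} {v : K.Cube 0} : v ∈ (span K S).cells 0 ↔ v ∈ S := by
  constructor
  · intro h
    have := h (fun _ => false)
    rwa [vertex_zero] at this
  · intro h x
    rwa [vertex_zero]

theorem mem_span {S : Set (K.Cube 0)} {n : ℕ} {c : K.Cube n} :
    c ∈ (span K S).cells n ↔ ∀ x, K.vertex c x ∈ S := Iff.rfl

theorem IsConvex.mem_iff (hY : Y.IsConvex) {n : ℕ} {c : K.Cube n} :
    c ∈ Y.cells n ↔ ∀ x, K.vertex c x ∈ Y.cells 0 := ⟨fun h => Y.vertex_mem h, hY.full n c⟩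

theorem containsPath_span {S : Set (K.Cube 0)} {a b : K.Cube 0} {γ : K.graph.Walk a b} :
    (span K S).ContainsPath γ ↔ ∀ w ∈ γ.support, w ∈ S := by
  constructor
  · exact fun h w hw => mem_span_zero.1 (h.1 w hw)
  · refine fun h => ⟨fun w hw => mem_span_zero.2 (h w hw), fun d hd e h1 h2 => ?_⟩
    refine forall_vertex_edge (P := (· ∈ S)) ?_ ?_
    · rw [h1]
      exact h _ (γ.dart_fst_mem_support_of_mem_darts hd)
    · rw [h2]
      exact h _ (γ.dart_snd_mem_support_of_mem_darts hd)

end Subcomplex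

open Subcomplex

theorem IsGeodesic.dist_add {a b w : K.Cube 0} {γ : K.graph.Walk a b} (hK : K.IsCATZero)
    (h : IsGeodesic γ) (hw : w ∈ γ.support) :
    K.graph.dist a w + K.graph.dist w b = K.graph.dist a b := by
  obtain ⟨q, r, rfl⟩ := SimpleGraph.Walk.mem_support_iff_exists_append.1 hw
  rw [IsGeodesic, SimpleGraph.Walk.length_append] at h
  have := SimpleGraph.dist_le q
  have := SimpleGraph.dist_le r
  have := hK.dist_triangle a w b
  omega

theorem Subcomplex.isConvex_span (hK : K.IsCATZero) {S : Set (K.Cube 0)}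
    (h : ∀ a ∈ S, ∀ b ∈ S, ∀ w, K.graph.dist a w + K.graph.dist w b = K.graph.dist a b → w ∈ S) :
    (span K S).IsConvex where
  full n c hc x := mem_span_zero.1 (hc x)
  geodesic a ha b hb γ hγ := by
    rw [containsPath_span]
    exact fun w hw => h a (mem_span_zero.1 ha) b (mem_span_zero.1 hb) w (hγ.dist_add hK hw)

/-! ### Automorphisms -/

/-- Automorphisms act on cubes. -/
instance {n : ℕ} : MulAction K.Aut (K.Cube n) where
  smul g c := g.1 n c
  one_smul _ := rfl
  mul_smul _ _ _ := rfl

theorem smul_def (g : K.Aut) {n : ℕ} (c : K.Cube n) : g • c = g.1 n c := rfl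

theorem smul_vertex (g : K.Aut) {n : ℕ} (c : K.Cube n) (x : Fin n → Bool) :
    g • K.vertex c x = K.vertex (g • c) x := g.2 _ _

theorem smul_edge (g : K.Aut) {n : ℕ} (c : K.Cube n) (x : Fin n → Bool) (i : Fin n) :
    g • K.edge c x i = K.edge (g • c) x i := g.2 _ _

theorem src_smul (g : K.Aut) (e : K.Cube 1) : K.src (g • e) = g • K.src e := (g.2 _ _).symm

theorem tgt_smul (g : K.Aut) (e : K.Cube 1) : K.tgt (g • e) = g • K.tgt e := (g.2 _ _).symm

theorem IsEdgePath.smul (g : K.Aut) {v w : K.Cube 0} {l : List (K.Cube 1)}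
    (h : K.IsEdgePath v l w) : K.IsEdgePath (g • v) (l.map (g • ·)) (g • w) := by
  induction h with
  | nil v => exact .nil _
  | cons e l w _ ih =>
    rw [List.map_cons, isEdgePath_cons_iff, src_smul, tgt_smul]
    exact ⟨rfl, ih⟩

theorem IsCATZero.dist_smul (hK : K.IsCATZero) (g : K.Aut) (v w : K.Cube 0) :
    K.graph.dist (g • v) (g • w) = K.graph.dist v w := by
  have key : ∀ (g : K.Aut) (v w : K.Cube 0), K.graph.dist (g • v) (g • w) ≤ K.graph.dist v w := by
    intro g v w
    obtain ⟨l, hl, hl'⟩ := exists_isEdgePath_length_eq_dist hK.2 v w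
    simpa [hl'] using (hl.smul g).dist_le
  refine (key g v w).antisymm ?_
  simpa using key g⁻¹ (g • v) (g • w)

theorem IsCATZero.smul_mem_side (hK : K.IsCATZero) (g : K.Aut) {e : K.Cube 1} {v : K.Cube 0} :
    g • v ∈ side (g • e) ↔ v ∈ side e := by
  rw [hK.mem_side, hK.mem_side, src_smul, tgt_smul, hK.dist_smul, hK.dist_smul]

theorem IsCATZero.smul_mem_side' (hK : K.IsCATZero) (g : K.Aut) {e : K.Cube 1} {v : K.Cube 0} :
    g • v ∈ side e ↔ v ∈ side (g⁻¹ • e) := by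
  rw [← hK.smul_mem_side g (e := g⁻¹ • e), smul_inv_smul]

namespace Subcomplex

variable {Y : K.Subcomplex} {g : K.Aut}

theorem mem_translate {g : K.Aut} {n : ℕ} {c : K.Cube n} :
    c ∈ (Y.translate g).cells n ↔ g⁻¹ • c ∈ Y.cells n := by
  constructor
  · rintro ⟨d, hd, rfl⟩
    rw [← smul_def, inv_smul_smul]
    exact hd
  · intro h
    exact ⟨_, h, smul_inv_smul g c⟩

/-- The automorphisms that preserve `Y`. -/
def stabilizer (Y : K.Subcomplex) : Subgroup K.Aut where
  carrier := {g | ∀ (n : ℕ) (c : K.Cube n), g • c ∈ Y.cells n ↔ c ∈ Y.cells n}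
  one_mem' := by simp
  mul_mem' := by
    intro g h hg hh n c
    rw [mul_smul, hg, hh]
  inv_mem' := by
    intro g hg n c
    rw [← hg, smul_inv_smul]

theorem mem_stabilizer_of_translate_eq (h : Y.translate g = Y) : g ∈ Y.stabilizer := by
  intro n c
  conv_lhs => rw [← h]
  rw [mem_translate, inv_smul_smul]

theorem translate_eq (h : g ∈ Y.stabilizer) : Y.translate g = Y := by
  ext n c
  rw [mem_translate]
  exact Y.stabilizer.inv_mem h n c

theorem smul_mem_hyp (hg : g ∈ Y.stabilizer) {e f : K.Cube 1} :
    g • f ∈ Y.hyp (g • e) ↔ f ∈ Y.hyp e := by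
  have key : ∀ g ∈ Y.stabilizer, ∀ {e f : K.Cube 1}, f ∈ Y.hyp e → g • f ∈ Y.hyp (g • e) := by
    intro g hg e f h
    induction h with
    | rel e f h =>
      obtain ⟨n, c, i, x, y, hc, rfl, rfl⟩ := h
      exact .rel _ _ ⟨n, g • c, i, x, y, (hg n c).2 hc, smul_edge g c x i, smul_edge g c y i⟩
    | refl e => exact .refl _
    | symm e f _ ih => exact .symm _ _ ih
    | trans e f g _ _ ih₁ ih₂ => exact .trans _ _ _ ih₁ ih₂
  refine ⟨fun h => ?_, key g hg⟩
  simpa using key g⁻¹ (Y.stabilizer.inv_mem hg) h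

theorem deep_smul (hK : K.IsCATZero) (hg : g ∈ Y.stabilizer) {e : K.Cube 1} :
    Y.Deep (g • e) ↔ Y.Deep e := by
  have key : ∀ g ∈ Y.stabilizer, ∀ {e : K.Cube 1}, Y.Deep e → Y.Deep (g • e) := by
    intro g hg e h r
    obtain ⟨v, hv, hv'⟩ := h r
    refine ⟨g • v, ⟨(hg 0 v).2 hv.1, (hK.smul_mem_side g).2 hv.2⟩, fun f hf => ?_⟩
    have := hv' (g⁻¹ • f) ((smul_mem_hyp hg).1 (by rwa [smul_inv_smul]))
    rwa [← hK.dist_smul g, src_smul, smul_inv_smul] at this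
  refine ⟨fun h => ?_, key g hg⟩
  simpa using key g⁻¹ (Y.stabilizer.inv_mem hg) h

end Subcomplex

/-! ### Deck transformations -/

section Deck

variable {L : CubeComplex.{v}} {p : Hom K L}

/-- A deck transformation that fixes a vertex is trivial. -/
theorem Hom.IsCovering.eq_one_of_smul_eq (hp : p.IsCovering) (hc : K.IsConnected) {g : K.Aut}
    (hg : g ∈ p.deck) {v : K.Cube 0} (h : g • v = v) : g = 1 := by
  have hcube : ∀ (n : ℕ) (c : K.Cube n), g • K.origin c = K.origin c → g • c = c := by
    intro n c hc
    refine hp.eq_of_map_eq ?_ (hg n c)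
    rw [← hc]
    exact (smul_vertex g c _).symm
  have hvert : ∀ {v w : K.Cube 0} {l : List (K.Cube 1)}, K.IsEdgePath v l w → g • v = v →
      g • w = w := by
    intro v w l hl
    induction hl with
    | nil v => exact fun h => h
    | cons e l w _ ih =>
      intro h
      refine ih ?_
      rw [← tgt_smul, hcube 1 e h]
  apply Subtype.ext
  funext n
  ext c
  obtain ⟨l, hl⟩ := hc.2 v (K.origin c)
  exact hcube n c (hvert hl h)

theorem Hom.IsCovering.finite_edges (hp : p.IsCovering) (hL : L.IsCompact) (v : K.Cube 0) :
    {e : K.Cube 1 | K.src e = v}.Finite := by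
  have : Finite (Σ n, L.Cube n) := hL
  refine Set.Finite.of_finite_image (f := fun e => (⟨1, p.toFun 1 e⟩ : Σ n, L.Cube n))
    (Set.toFinite _) ?_
  intro e he f hf h
  exact hp.eq_of_map_eq (he.trans hf.symm) (by simpa using h)

theorem Hom.IsCovering.finite_ball (hp : p.IsCovering) (hL : L.IsCompact) (hK : K.IsCATZero)
    (v : K.Cube 0) (r : ℕ) : {w : K.Cube 0 | K.graph.dist v w ≤ r}.Finite := by
  induction r generalizing v with
  | zero =>
    refine (Set.finite_singleton v).subset fun w hw => ?_
    exact (hK.dist_eq_zero.1 (Nat.le_zero.1 hw)).symm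
  | succ r ih =>
    refine ((Set.finite_singleton v).union
      ((hp.finite_edges hL v).biUnion fun e _ => ih (K.tgt e))).subset fun w hw => ?_
    by_cases h : v = w
    · exact .inl h.symm
    · obtain ⟨e, he, hd⟩ := hK.exists_first_edge h
      refine .inr (Set.mem_biUnion he ?_)
      rw [Set.mem_ofPred_eq] at hw ⊢
      omega

end Deck

open Subcomplex

/-! ### Convex subcomplexes with a cocompact action of an infinite cyclic group -/

/-- A convex subcomplex `Y` of a locally finite CAT(0) cube complex on which `⟨φ⟩` acts
cocompactly, where `φ` has infinite order and generates a group that acts freely. -/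
structure IsLine (Y : K.Subcomplex) (φ : K.Aut) : Prop where
  catZero : K.IsCATZero
  finite_ball : ∀ (v : K.Cube 0) (r : ℕ), {w : K.Cube 0 | K.graph.dist v w ≤ r}.Finite
  convex : Y.IsConvex
  mem_stabilizer : φ ∈ Y.stabilizer
  free : ∀ (k : ℤ) (v : K.Cube 0), φ ^ k • v = v → k = 0
  cocompact : ∃ F : Set (Σ n, K.Cube n), F.Finite ∧
    ∀ (n : ℕ), ∀ c ∈ Y.cells n, ∃ k : ℤ, (⟨n, φ ^ k • c⟩ : Σ n, K.Cube n) ∈ F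

/-- The automorphisms that preserve each of the two sides of `e`. -/
def sideStabilizer (e : K.Cube 1) : Subgroup K.Aut where
  carrier := {g | ∀ v, g • v ∈ side e ↔ v ∈ side e}
  one_mem' := by simp
  mul_mem' := by
    intro g h hg hh v
    rw [mul_smul, hg, hh]
  inv_mem' := by
    intro g hg v
    rw [← hg, smul_inv_smul]

theorem mem_sideStabilizer {e : K.Cube 1} {g : K.Aut} :
    g ∈ sideStabilizer e ↔ ∀ v, g • v ∈ side e ↔ v ∈ side e := Iff.rfl

theorem sideStabilizer_eq {e f : K.Cube 1}
    (h : side f = side e ∨ side f = (side e)ᶜ) : sideStabilizer f = sideStabilizer e := by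
  ext g
  rw [mem_sideStabilizer, mem_sideStabilizer]
  rcases h with h | h <;> simp only [h, Set.mem_compl_iff, not_iff_not]

theorem sideStabilizer_smul (hK : K.IsCATZero) {e : K.Cube 1} {g h : K.Aut} (hc : g * h = h * g) :
    h ∈ sideStabilizer (g • e) ↔ h ∈ sideStabilizer e := by
  rw [mem_sideStabilizer, mem_sideStabilizer, (MulAction.surjective g).forall]
  simp only [← mul_smul, ← hc]
  simp only [mul_smul, hK.smul_mem_side]

theorem mem_sideStabilizer_of_side_smul_eq (hK : K.IsCATZero) {e : K.Cube 1} {g : K.Aut}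
    (h : side (g • e) = side e) : g ∈ sideStabilizer e := by
  intro v
  rw [← hK.smul_mem_side g (v := v), h]

/-- The sides of `e` are preserved by some nontrivial power of `φ`. -/
def Periodic (φ : K.Aut) (e : K.Cube 1) : Prop :=
  ∃ k : ℕ, 0 < k ∧ φ ^ k ∈ sideStabilizer e

namespace IsLine

variable {Y : K.Subcomplex} {φ : K.Aut}

theorem zpow_mem (h : IsLine Y φ) (k : ℤ) : φ ^ k ∈ Y.stabilizer :=
  Y.stabilizer.zpow_mem h.mem_stabilizer k

theorem dist_zpow (h : IsLine Y φ) (k : ℤ) (v w : K.Cube 0) :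
    K.graph.dist (φ ^ k • v) (φ ^ k • w) = K.graph.dist v w := h.catZero.dist_smul _ _ _

theorem dist_zpow_zpow (h : IsLine Y φ) (i j : ℤ) (v : K.Cube 0) :
    K.graph.dist (φ ^ i • v) (φ ^ j • v) = K.graph.dist v (φ ^ (j - i) • v) := by
  rw [← h.dist_zpow i v, ← mul_smul, ← zpow_add]
  congr 3
  ring

/-- Every cube of `Y` has a translate within a uniform distance of a given vertex. -/
theorem exists_dist_le (h : IsLine Y φ) (y₀ : K.Cube 0) : ∃ R : ℕ, ∀ (n : ℕ), ∀ c ∈ Y.cells n,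
    ∃ k : ℤ, ∀ x, K.graph.dist y₀ (K.vertex (φ ^ k • c) x) ≤ R := by
  obtain ⟨F, hF, hcov⟩ := h.cocompact
  have hfin : (⋃ s ∈ F, Set.range fun x => K.graph.dist y₀ (K.vertex s.2 x)).Finite :=
    hF.biUnion fun s _ => Set.finite_range _
  obtain ⟨R, hR⟩ := hfin.bddAbove
  refine ⟨R, fun n c hc => ?_⟩
  obtain ⟨k, hk⟩ := hcov n c hc
  exact ⟨k, fun x => hR (Set.mem_biUnion hk ⟨x, rfl⟩)⟩

theorem exists_dist_le_zero (h : IsLine Y φ) (y₀ : K.Cube 0) : ∃ R : ℕ, ∀ v ∈ Y.cells 0,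
    ∃ k : ℤ, K.graph.dist (φ ^ k • y₀) v ≤ R := by
  obtain ⟨R, hR⟩ := h.exists_dist_le y₀
  refine ⟨R, fun v hv => ?_⟩
  obtain ⟨k, hk⟩ := hR 0 v hv
  refine ⟨-k, ?_⟩
  have := hk (fun _ => false)
  rw [vertex_zero] at this
  rw [← h.dist_zpow k, ← mul_smul, ← zpow_add]
  simpa using this

theorem zpow_smul_injective (h : IsLine Y φ) (v : K.Cube 0) :
    Function.Injective fun k : ℤ => φ ^ k • v := by
  intro i j (hij : φ ^ i • v = φ ^ j • v)
  have : φ ^ (j - i) • v = v := by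
    rw [sub_eq_neg_add, zpow_add, mul_smul, ← hij, ← mul_smul, ← zpow_add]
    simp
  have := h.free _ _ this
  omega

/-- Properness: only boundedly many powers of `φ` move a vertex by a bounded distance. -/
theorem exists_natAbs_le (h : IsLine Y φ) (y₀ : K.Cube 0) (r : ℕ) : ∃ N : ℕ, ∀ k : ℤ,
    K.graph.dist y₀ (φ ^ k • y₀) ≤ r → k.natAbs ≤ N := by
  have hfin := (h.finite_ball y₀ r).preimage (h.zpow_smul_injective y₀).injOn
  obtain ⟨N, hN⟩ := (hfin.image Int.natAbs).bddAbove
  exact ⟨N, fun k hk => hN ⟨k, hk, rfl⟩⟩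

theorem dist_zpow_le (h : IsLine Y φ) (y₀ : K.Cube 0) (k : ℤ) :
    K.graph.dist y₀ (φ ^ k • y₀) ≤ k.natAbs * K.graph.dist y₀ (φ • y₀) := by
  have key : ∀ k : ℕ, K.graph.dist y₀ (φ ^ (k : ℤ) • y₀) ≤ k * K.graph.dist y₀ (φ • y₀) := by
    intro k
    induction k with
    | zero => simp
    | succ k ih =>
      have t := h.catZero.dist_triangle y₀ (φ ^ (k : ℤ) • y₀) (φ ^ ((k + 1 : ℕ) : ℤ) • y₀)
      rw [h.dist_zpow_zpow] at t
      rw [show ((k + 1 : ℕ) : ℤ) - k = 1 by push_cast; ring, zpow_one] at t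
      rw [add_mul, one_mul]
      omega
  rcases Int.natAbs_eq k with hk | hk
  · conv_lhs => rw [hk]
    exact key _
  · conv_lhs => rw [hk]
    rw [SimpleGraph.dist_comm, ← h.dist_zpow k.natAbs, ← mul_smul, ← zpow_add]
    simpa using key k.natAbs

theorem exists_edge_representatives (h : IsLine Y φ) : ∃ E : Set (K.Cube 1), E.Finite ∧
    E ⊆ Y.cells 1 ∧ ∀ e ∈ Y.cells 1, ∃ k : ℤ, φ ^ k • e ∈ E := by
  obtain ⟨F, hF, hcov⟩ := h.cocompact
  refine ⟨{e | e ∈ Y.cells 1 ∧ (⟨1, e⟩ : Σ n, K.Cube n) ∈ F}, ?_, fun e he => he.1, ?_⟩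
  · exact (hF.preimage (sigma_mk_injective (i := 1)).injOn).subset fun e he => he.2
  · intro e he
    obtain ⟨k, hk⟩ := hcov 1 e he
    exact ⟨k, (h.zpow_mem k 1 e).2 he, hk⟩

/-- A bound that is invariant under `φ` and holds for each edge holds uniformly. -/
theorem exists_uniform_bound (h : IsLine Y φ) {P : K.Cube 1 → ℕ → Prop}
    (hmono : ∀ e r s, r ≤ s → P e r → P e s)
    (hinv : ∀ e r (k : ℤ), e ∈ Y.cells 1 → P (φ ^ k • e) r → P e r)
    (hP : ∀ e ∈ Y.cells 1, ∃ r, P e r) : ∃ r, ∀ e ∈ Y.cells 1, P e r := by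
  obtain ⟨E, hE, hEY, hcov⟩ := h.exists_edge_representatives
  choose! r hr using hP
  obtain ⟨R, hR⟩ := (hE.image r).bddAbove
  refine ⟨R, fun e he => ?_⟩
  obtain ⟨k, hk⟩ := hcov e he
  exact hinv e R k he (hmono _ _ _ (hR ⟨_, hk, rfl⟩) (hr _ (hEY hk)))

theorem periodic_zpow_smul (h : IsLine Y φ) {e : K.Cube 1} {k : ℤ} :
    Periodic φ (φ ^ k • e) ↔ Periodic φ e := by
  unfold Periodic
  simp only [sideStabilizer_smul h.catZero ((Commute.refl φ).zpow_left k |>.pow_right _).eq]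

/-- A single power of `φ` preserves the sides of all periodic edges. -/
theorem exists_pow_mem_sideStabilizer (h : IsLine Y φ) : ∃ n : ℕ, 0 < n ∧ ∀ e ∈ Y.cells 1,
    Periodic φ e → φ ^ n ∈ sideStabilizer e := by
  obtain ⟨E, hE, hEY, hcov⟩ := h.exists_edge_representatives
  have key : ∃ n : ℕ, 0 < n ∧ ∀ e ∈ E, Periodic φ e →
      φ ^ n ∈ sideStabilizer e := by
    clear hEY hcov
    induction E, hE using Set.Finite.induction_on with
    | empty => exact ⟨1, one_pos, by simp⟩
    | @insert a s _ _ ih =>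
      obtain ⟨n, hn, ih⟩ := ih
      by_cases ha : Periodic φ a
      · obtain ⟨k, hk, hka⟩ := ha
        refine ⟨k * n, Nat.mul_pos hk hn, ?_⟩
        rintro e (rfl | he) hp
        · rw [pow_mul]
          exact Subgroup.pow_mem _ hka n
        · rw [mul_comm, pow_mul]
          exact Subgroup.pow_mem _ (ih e he hp) k
      · refine ⟨n, hn, ?_⟩
        rintro e (rfl | he) hp
        · exact absurd hp ha
        · exact ih e he hp
  obtain ⟨n, hn, key⟩ := key
  refine ⟨n, hn, fun e he hp => ?_⟩
  obtain ⟨k, hk⟩ := hcov e he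
  have := key _ hk (h.periodic_zpow_smul.2 hp)
  rwa [sideStabilizer_smul h.catZero ((Commute.refl φ).zpow_left k |>.pow_right _).eq] at this

/-- The hyperplane of a periodic edge is coarsely dense in `Y`, so its sides are shallow. -/
theorem not_deep_of_periodic (h : IsLine Y φ) {e : K.Cube 1} (he : e ∈ Y.cells 1)
    (hp : Periodic φ e) : ¬ Y.Deep e := by
  obtain ⟨k, hk, hke⟩ := hp
  obtain ⟨R, hR⟩ := h.exists_dist_le_zero (K.src e)
  intro hd
  obtain ⟨v, hv, hv'⟩ := hd (R + k * K.graph.dist (K.src e) (φ • K.src e))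
  obtain ⟨i, hi⟩ := hR v hv.1
  -- The translate of `e` by the multiple of `k` just below `i` lies in the hyperplane.
  have hmem : φ ^ ((k : ℤ) * (i / k)) ∈ sideStabilizer e := by
    rw [zpow_mul, zpow_natCast]
    exact Subgroup.zpow_mem _ hke _
  have hf : φ ^ ((k : ℤ) * (i / k)) • e ∈ Y.hyp e := by
    refine h.convex.mem_hyp h.catZero he ((h.zpow_mem _ 1 e).2 he) ?_
    rw [src_smul, tgt_smul, hmem, hmem]
    have := h.catZero.src_mem_side e
    have := h.catZero.tgt_notMem_side e
    tauto
  have h1 := hv' _ hf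
  rw [src_smul] at h1
  have h2 := h.catZero.dist_triangle v (φ ^ i • K.src e) (φ ^ ((k : ℤ) * (i / k)) • K.src e)
  rw [SimpleGraph.dist_comm] at hi
  rw [SimpleGraph.dist_comm (u := φ ^ i • K.src e), h.dist_zpow_zpow] at h2
  have h3 := h.dist_zpow_le (K.src e) (i - k * (i / k))
  have h4 : (i - k * (i / k)).natAbs ≤ k := by
    have := Int.emod_nonneg i (b := k) (by omega)
    have := Int.emod_lt_of_pos i (b := k) (by omega)
    have := Int.emod_def i k
    omega
  have h5 := Nat.mul_le_mul_right (K.graph.dist (K.src e) (φ • K.src e)) h4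
  omega

theorem periodic_inv (h : IsLine Y φ) {e : K.Cube 1} :
    Periodic φ (K.inv e) ↔ Periodic φ e := by
  unfold Periodic
  rw [sideStabilizer_eq (.inr (h.catZero.side_inv e))]

theorem isTrivialHyperplane_of_periodic (h : IsLine Y φ) {e : K.Cube 1} (he : e ∈ Y.cells 1)
    (hp : Periodic φ e) : Y.IsTrivialHyperplane (Y.hyp e) :=
  h.convex.isTrivialHyperplane h.catZero he (h.not_deep_of_periodic he hp)
    (h.not_deep_of_periodic (Y.inv_mem he) (h.periodic_inv.2 hp))

/-- By the pigeonhole principle an infinite hyperplane contains two edges that have the same sides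
and differ by a power of `φ`. -/
theorem finite_hyp (h : IsLine Y φ) {e : K.Cube 1} (he : e ∈ Y.cells 1)
    (hp : ¬ Periodic φ e) : (Y.hyp e).Finite := by
  by_contra hinf
  obtain ⟨E, hE, -, hcov⟩ := h.exists_edge_representatives
  choose! k hk using hcov
  obtain ⟨f, hf, f', hf', hne, heq⟩ := Set.Infinite.exists_ne_map_eq_of_mapsTo
    (t := E ×ˢ (Set.univ : Set Prop)) (f := fun f => (φ ^ k f • f, side f = side e)) hinf
    (fun f hf => ⟨hk f (mem_of_mem_hyp he hf), Set.mem_univ _⟩) (hE.prod Set.finite_univ)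
  obtain ⟨h1, h2⟩ := Prod.mk.inj heq
  have hside : side f' = side f := by
    rcases side_eq_of_mem_hyp h.catZero hf with h3 | h3 <;>
      rcases side_eq_of_mem_hyp h.catZero hf' with h4 | h4
    · rw [h3, h4]
    · exact (h2 ▸ h3 : side f' = side e).trans h3.symm
    · exact h4.trans (h2.symm ▸ h4 : side f = side e).symm
    · rw [h3, h4]
  have hff : φ ^ (k f - k f') • f = f' := by
    rw [sub_eq_neg_add, zpow_add, mul_smul, h1, zpow_neg, inv_smul_smul]
  have hm : φ ^ (k f - k f') ∈ sideStabilizer e := by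
    rw [← sideStabilizer_eq (side_eq_of_mem_hyp h.catZero hf)]
    exact mem_sideStabilizer_of_side_smul_eq h.catZero (by rw [hff, hside])
  have h0 : k f - k f' ≠ 0 := by
    intro h0
    rw [h0, zpow_zero, one_smul] at hff
    exact hne hff
  refine hp ⟨(k f - k f').natAbs, by omega, ?_⟩
  rcases Int.natAbs_eq (k f - k f') with h5 | h5
  · rw [← zpow_natCast, ← h5]
    exact hm
  · rw [h5, zpow_neg, Subgroup.inv_mem_iff, zpow_natCast] at hm
    exact hm

/-- Hyperplanes that are not periodic have uniformly bounded diameter. -/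
theorem exists_hyp_diam_le (h : IsLine Y φ) : ∃ R : ℕ, ∀ e ∈ Y.cells 1,
    ¬ Periodic φ e → ∀ f ∈ Y.hyp e, K.graph.dist (K.src e) (K.src f) ≤ R := by
  refine h.exists_uniform_bound (P := fun e R => ¬ Periodic φ e →
    ∀ f ∈ Y.hyp e, K.graph.dist (K.src e) (K.src f) ≤ R) ?_ ?_ ?_
  · exact fun e r s hrs H hp f hf => (H hp f hf).trans hrs
  · intro e r k he H hp f hf
    have := H (by rwa [h.periodic_zpow_smul]) (φ ^ k • f) ((smul_mem_hyp (h.zpow_mem k)).2 hf)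
    rwa [src_smul, src_smul, h.dist_zpow] at this
  · intro e he
    by_cases hp : Periodic φ e
    · exact ⟨0, fun h => absurd hp h⟩
    · obtain ⟨R, hR⟩ := ((h.finite_hyp he hp).image
        fun f => K.graph.dist (K.src e) (K.src f)).bddAbove
      exact ⟨R, fun _ f hf => hR ⟨f, hf, rfl⟩⟩

/-- Shallow sides of hyperplanes that are not periodic are uniformly bounded. -/
theorem exists_half_le (h : IsLine Y φ) : ∃ R : ℕ, ∀ e ∈ Y.cells 1,
    ¬ Periodic φ e → ¬ Y.Deep e → ∀ v ∈ Y.half e, K.graph.dist v (K.src e) ≤ R := by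
  obtain ⟨D, hD⟩ := h.exists_hyp_diam_le
  refine h.exists_uniform_bound (P := fun e R => ¬ Periodic φ e → ¬ Y.Deep e →
    ∀ v ∈ Y.half e, K.graph.dist v (K.src e) ≤ R) ?_ ?_ ?_
  · exact fun e r s hrs H hp hd v hv => (H hp hd v hv).trans hrs
  · intro e r k he H hp hd v hv
    have := H (by rwa [h.periodic_zpow_smul]) (by rwa [deep_smul h.catZero (h.zpow_mem k)])
      (φ ^ k • v) ⟨(h.zpow_mem k 0 v).2 hv.1, (h.catZero.smul_mem_side _).2 hv.2⟩
    rwa [src_smul, h.dist_zpow] at this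
  · intro e he
    by_cases hp : Periodic φ e
    · exact ⟨0, fun h => absurd hp h⟩
    · by_cases hd : Y.Deep e
      · exact ⟨0, fun _ h => absurd hd h⟩
      · have hd' := hd
        unfold Deep IsDeep at hd'
        push Not at hd'
        obtain ⟨r, hr⟩ := hd'
        refine ⟨r + D, fun _ _ v hv => ?_⟩
        obtain ⟨f, hf, hvf⟩ := hr v hv
        have h1 := hD e he hp f hf
        have h2 := h.catZero.dist_triangle v (K.src f) (K.src e)
        rw [SimpleGraph.dist_comm (u := K.src f)] at h2
        omega

/-! ### The two ends -/

/-- The orbit of a vertex passes close to the interval between two vertices that are close to the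
orbit. -/
theorem exists_between (h : IsLine Y φ) (y₀ : K.Cube 0) (r : ℕ) : ∃ R : ℕ, ∀ u ∈ Y.cells 0,
    ∀ u' ∈ Y.cells 0, ∀ i t j : ℤ, i ≤ t → t ≤ j → K.graph.dist (φ ^ i • y₀) u ≤ r →
    K.graph.dist (φ ^ j • y₀) u' ≤ r → ∃ w ∈ Y.cells 0,
      K.graph.dist u w + K.graph.dist w u' = K.graph.dist u u' ∧
      K.graph.dist w (φ ^ t • y₀) ≤ R := by
  obtain ⟨R, hR⟩ := h.exists_dist_le_zero y₀
  obtain ⟨N, hN⟩ := h.exists_natAbs_le y₀ (2 * max r R + 1)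
  have near : ∀ (s t : ℤ) (w : K.Cube 0), K.graph.dist (φ ^ s • y₀) w ≤ max r R →
      (t - s).natAbs ≤ N →
      K.graph.dist w (φ ^ t • y₀) ≤ max r R + N * K.graph.dist y₀ (φ • y₀) := by
    intro s t w hw hst
    have h1 := h.catZero.dist_triangle w (φ ^ s • y₀) (φ ^ t • y₀)
    rw [h.dist_zpow_zpow, SimpleGraph.dist_comm (u := w) (v := φ ^ s • y₀)] at h1
    have h2 := h.dist_zpow_le y₀ (t - s)
    have h3 := Nat.mul_le_mul_right (K.graph.dist y₀ (φ • y₀)) hst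
    omega
  have close : ∀ (s t : ℤ) (w w' : K.Cube 0), K.graph.dist (φ ^ s • y₀) w ≤ max r R →
      K.graph.dist (φ ^ t • y₀) w' ≤ max r R → K.graph.dist w w' ≤ 1 → (t - s).natAbs ≤ N := by
    intro s t w w' hw hw' hww
    apply hN
    rw [← h.dist_zpow_zpow]
    have h1 := h.catZero.dist_triangle (φ ^ s • y₀) w (φ ^ t • y₀)
    have h2 := h.catZero.dist_triangle w w' (φ ^ t • y₀)
    rw [SimpleGraph.dist_comm (u := w')] at h2
    omega
  refine ⟨max r R + N * K.graph.dist y₀ (φ • y₀), ?_⟩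
  intro u hu u' hu' i t j hit htj hiu hju
  -- The vertices that are close to a point of the orbit with index less than `t`.
  let S : Set (K.Cube 0) := {v | ∃ s < t, K.graph.dist (φ ^ s • y₀) v ≤ max r R}
  rcases hit.eq_or_lt with rfl | hit
  · refine ⟨u, hu, by simp, near i i u (by omega) (by simp)⟩
  have huS : u ∈ S := ⟨i, hit, by omega⟩
  by_cases huS' : u' ∈ S
  · obtain ⟨s, hs, hsu⟩ := huS'
    have := close s j u' u' hsu (by omega) (by simp)
    exact ⟨u', hu', by simp, near j t u' (by omega) (by omega)⟩
  · obtain ⟨f, hf, ⟨s, hs, hsf⟩, h2, h3⟩ :=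
      h.convex.exists_edge_of_mem_of_notMem h.catZero hu hu' huS huS'
    refine ⟨K.src f, Y.src_mem hf, ?_, ?_⟩
    · have t1 := h.catZero.dist_triangle u (K.src f) u'
      have t2 := h.catZero.dist_triangle (K.src f) (K.tgt f) u'
      rw [h.catZero.dist_src_tgt] at t2
      omega
    · obtain ⟨k, hk⟩ := hR _ (Y.tgt_mem hf)
      have hkt : t ≤ k := by
        by_contra hkt
        exact h2 ⟨k, by omega, by omega⟩
      have := close s k _ _ hsf (by omega) (h.catZero.dist_src_tgt f).le
      exact near s t _ hsf (by omega)

/-- If `m` lies between `a` and `b` and is far from both of them, then the indices of nearby points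
of the orbit are ordered in the same way. -/
theorem index_between (h : IsLine Y φ) (y₀ : K.Cube 0) (r : ℕ) : ∃ R : ℕ, ∀ a ∈ Y.cells 0,
    ∀ m ∈ Y.cells 0, ∀ b ∈ Y.cells 0, ∀ i t j : ℤ, K.graph.dist (φ ^ i • y₀) a ≤ r →
    K.graph.dist (φ ^ t • y₀) m ≤ r → K.graph.dist (φ ^ j • y₀) b ≤ r →
    K.graph.dist a m + K.graph.dist m b = K.graph.dist a b →
    R < K.graph.dist a m → R < K.graph.dist m b → (i < t ∧ t < j) ∨ (j < t ∧ t < i) := by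
  obtain ⟨R, hR⟩ := h.exists_between y₀ r
  have key : ∀ a ∈ Y.cells 0, ∀ m ∈ Y.cells 0, ∀ b ∈ Y.cells 0, ∀ i t j : ℤ,
      K.graph.dist (φ ^ i • y₀) a ≤ r →
      K.graph.dist (φ ^ t • y₀) m ≤ r → K.graph.dist (φ ^ j • y₀) b ≤ r →
      K.graph.dist a m + K.graph.dist m b = K.graph.dist a b →
      R + r < K.graph.dist a m → ¬ (t ≤ i ∧ i ≤ j) ∧ ¬ (j ≤ i ∧ i ≤ t) := by
    intro a ha m hm b hb i t j hi ht hj hd hlt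
    have fin : ∀ w, K.graph.dist m w + K.graph.dist w b = K.graph.dist m b →
        ¬ K.graph.dist w (φ ^ i • y₀) ≤ R := by
      intro w hw hwR
      have t1 := h.catZero.dist_triangle w (φ ^ i • y₀) a
      have t2 := h.catZero.dist_triangle a w b
      rw [SimpleGraph.dist_comm (u := a) (v := w)] at t2
      omega
    constructor
    · rintro ⟨h1, h2⟩
      obtain ⟨w, -, hw, hwR⟩ := hR m hm b hb t i j h1 h2 ht hj
      exact fin w hw hwR
    · rintro ⟨h1, h2⟩
      obtain ⟨w, -, hw, hwR⟩ := hR b hb m hm j i t h1 h2 hj ht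
      refine fin w ?_ hwR
      rw [SimpleGraph.dist_comm (u := m), SimpleGraph.dist_comm (v := b),
        SimpleGraph.dist_comm (u := m), ← hw, add_comm]
  refine ⟨R + r, ?_⟩
  intro a ha m hm b hb i t j hi ht hj hd h1 h2
  have k1 := key a ha m hm b hb i t j hi ht hj hd h1
  have k2 := key b hb m hm a ha j t i hj ht hi
    (by
      rw [SimpleGraph.dist_comm (u := b), SimpleGraph.dist_comm (v := a),
        SimpleGraph.dist_comm (u := b), ← hd, add_comm])
    (by rwa [SimpleGraph.dist_comm])
  omega

/-- Two vertices that are far from `m` towards the same end of `Y` are not separated by a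
hyperplane of bounded diameter close to `m`. -/
theorem exists_same_side (h : IsLine Y φ) (y₀ : K.Cube 0) (hy₀ : y₀ ∈ Y.cells 0) (r ρ : ℕ) :
    ∃ R : ℕ, ∀ e ∈ Y.cells 1, ∀ m, (∀ f ∈ Y.hyp e, K.graph.dist m (K.src f) ≤ ρ) →
      ∀ x ∈ Y.cells 0, ∀ y ∈ Y.cells 0, ∀ i t j : ℤ, K.graph.dist (φ ^ i • y₀) x ≤ r →
      K.graph.dist (φ ^ t • y₀) m ≤ r → K.graph.dist (φ ^ j • y₀) y ≤ r →
      (t ≤ i ∧ t ≤ j ∨ i ≤ t ∧ j ≤ t) →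
      R < K.graph.dist x m → R < K.graph.dist y m → (x ∈ side e ↔ y ∈ side e) := by
  set D := K.graph.dist y₀ (φ • y₀) with hD
  obtain ⟨N, hN⟩ := h.exists_natAbs_le y₀ (ρ + r + D + r)
  refine ⟨2 * r + N * D + ρ, ?_⟩
  intro e he m hm x hx y hy i t j hi ht hj hor hxm hym
  -- A short step away from `m` does not cross the hyperplane.
  have step : ∀ p ∈ Y.cells 0, ∀ q ∈ Y.cells 0, ∀ s, K.graph.dist p q ≤ s →
      ρ + s < K.graph.dist p m → (p ∈ side e ↔ q ∈ side e) := by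
    intro p hp q hq s hpq hpm
    have fin : ∀ f ∈ Y.cells 1, ¬ (K.src f ∈ side e ↔ K.tgt f ∈ side e) →
        K.graph.dist p (K.src f) + 1 + K.graph.dist (K.tgt f) q = K.graph.dist p q → False := by
      intro f hf hne hd
      have h1 := hm f (h.convex.mem_hyp h.catZero he hf hne)
      have h2 := h.catZero.dist_triangle p (K.src f) m
      rw [SimpleGraph.dist_comm (u := K.src f) (v := m)] at h2
      omega
    by_contra hne
    by_cases hps : p ∈ side e
    · obtain ⟨f, hf, h1, h2, h3⟩ := h.convex.exists_edge_of_mem_of_notMem h.catZero hp hq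
        (S := side e) hps (by tauto)
      exact fin f hf (by tauto) h3
    · obtain ⟨f, hf, h1, h2, h3⟩ := h.convex.exists_edge_of_mem_of_notMem h.catZero hp hq
        (S := (side e)ᶜ) hps (by rw [Set.notMem_compl_iff]; tauto)
      rw [Set.notMem_compl_iff] at h2
      exact fin f hf (by tauto) h3
  have orbit : ∀ s : ℤ, φ ^ s • y₀ ∈ Y.cells 0 := fun s => (h.zpow_mem s 0 y₀).2 hy₀
  have far : ∀ s : ℤ, N < (s - t).natAbs → ρ + r + D < K.graph.dist (φ ^ s • y₀) m := by
    intro s hs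
    by_contra hle
    have h1 := h.catZero.dist_triangle (φ ^ t • y₀) m (φ ^ s • y₀)
    rw [h.dist_zpow_zpow, SimpleGraph.dist_comm (u := m)] at h1
    have := hN (s - t) (by omega)
    omega
  have away : ∀ (p : K.Cube 0) (s : ℤ), K.graph.dist (φ ^ s • y₀) p ≤ r →
      2 * r + N * D + ρ < K.graph.dist p m → N < (s - t).natAbs := by
    intro p s hs hpm
    by_contra hle
    have h1 := h.catZero.dist_triangle p (φ ^ s • y₀) m
    have h2 := h.catZero.dist_triangle (φ ^ s • y₀) (φ ^ t • y₀) m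
    rw [SimpleGraph.dist_comm (u := p) (v := φ ^ s • y₀)] at h1
    rw [SimpleGraph.dist_comm (u := φ ^ s • y₀) (v := φ ^ t • y₀), h.dist_zpow_zpow] at h2
    have h3 := h.dist_zpow_le y₀ (s - t)
    have h4 := Nat.mul_le_mul_right D (not_lt.1 hle)
    rw [← hD] at h3
    omega
  have chain : ∀ i j : ℤ, i ≤ j → (∀ s, i ≤ s → s ≤ j → N < (s - t).natAbs) →
      (φ ^ i • y₀ ∈ side e ↔ φ ^ j • y₀ ∈ side e) := by
    intro i j hij
    induction j, hij using Int.leInduction with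
    | base => intro _; rfl
    | succ j hij ih =>
      intro hs
      refine (ih fun s h1 h2 => hs s h1 (by omega)).trans ?_
      refine step _ (orbit _) _ (orbit _) D ?_ ?_
      · rw [h.dist_zpow_zpow]
        simp [hD]
      · have := far j (hs j hij (by omega))
        omega
  have hxi := away x i hi hxm
  have hyj := away y j hj hym
  have ends : ∀ p ∈ Y.cells 0, ∀ s : ℤ, K.graph.dist (φ ^ s • y₀) p ≤ r → N < (s - t).natAbs →
      (φ ^ s • y₀ ∈ side e ↔ p ∈ side e) := by
    intro p hp s hs hN
    have := far s hN
    exact step _ (orbit _) p hp r hs (by omega)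
  rw [← ends x hx i hi hxi, ← ends y hy j hj hyj]
  rcases le_total i j with hij | hij
  · exact chain i j hij fun s h1 h2 => by omega
  · exact (chain j i hij fun s h1 h2 => by omega).symm

/-- A deep side of a hyperplane of bounded diameter close to `m` contains `a` or `b`, if `m` lies
between `a` and `b` and is far from both. -/
theorem exists_mem_side (h : IsLine Y φ) (ρ : ℕ) : ∃ R : ℕ, ∀ e ∈ Y.cells 1,
    ¬ Periodic φ e → Y.Deep e → ∀ a ∈ Y.cells 0, ∀ m ∈ Y.cells 0, ∀ b ∈ Y.cells 0,
    (∃ f ∈ Y.hyp e, K.graph.dist m (K.src f) ≤ ρ) →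
    K.graph.dist a m + K.graph.dist m b = K.graph.dist a b →
    R < K.graph.dist a m → R < K.graph.dist m b → a ∈ side e ∨ b ∈ side e := by
  rcases (Y.cells 0).eq_empty_or_nonempty with hY | ⟨y₀, hy₀⟩
  · refine ⟨0, fun e he => ?_⟩
    have := Y.src_mem he
    simp [hY] at this
  obtain ⟨r, hr⟩ := h.exists_dist_le_zero y₀
  obtain ⟨R₁, hR₁⟩ := h.index_between y₀ r
  obtain ⟨D, hD⟩ := h.exists_hyp_diam_le
  obtain ⟨R₂, hR₂⟩ := h.exists_same_side y₀ hy₀ r (ρ + 2 * D)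
  refine ⟨R₁ + R₂, ?_⟩
  rintro e he hp hdeep a ha m hm b hb ⟨f, hf, hmf⟩ hd h1 h2
  have hnear : ∀ f' ∈ Y.hyp e, K.graph.dist m (K.src f') ≤ ρ + 2 * D := by
    intro f' hf'
    have t1 := h.catZero.dist_triangle m (K.src f) (K.src f')
    have t2 := h.catZero.dist_triangle (K.src f) (K.src e) (K.src f')
    rw [SimpleGraph.dist_comm (u := K.src f) (v := K.src e)] at t2
    have := hD e he hp f hf
    have := hD e he hp f' hf'
    omega
  obtain ⟨v, hv, hv'⟩ := hdeep (R₂ + ρ)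
  have hvm : R₂ < K.graph.dist v m := by
    have := hv' f hf
    have := h.catZero.dist_triangle v m (K.src f)
    omega
  obtain ⟨i, hi⟩ := hr a ha
  obtain ⟨t, ht⟩ := hr m hm
  obtain ⟨j, hj⟩ := hr b hb
  obtain ⟨k, hk⟩ := hr v hv.1
  have hor := hR₁ a ha m hm b hb i t j hi ht hj hd (by omega) (by omega)
  rw [SimpleGraph.dist_comm (u := m)] at h2
  by_cases hcase : t ≤ k ∧ t ≤ j ∨ k ≤ t ∧ j ≤ t
  · exact .inr ((hR₂ e he m hnear v hv.1 b hb k t j hk ht hj hcase hvm (by omega)).1 hv.2)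
  · exact .inl ((hR₂ e he m hnear v hv.1 a ha k t i hk ht hi (by omega) hvm (by omega)).1 hv.2)

end IsLine

/-! ### Geodesics -/

theorem IsGeodesic.dist_add_of_le {a b u u' : K.Cube 0} {γ : K.graph.Walk a b}
    (hK : K.IsCATZero) (h : IsGeodesic γ) (hu : u ∈ γ.support) (hu' : u' ∈ γ.support)
    (hle : K.graph.dist a u ≤ K.graph.dist a u') :
    K.graph.dist a u + K.graph.dist u u' = K.graph.dist a u' := by
  have h1 := h.dist_add hK hu'
  obtain ⟨q, r, rfl⟩ := SimpleGraph.Walk.mem_support_iff_exists_append.1 hu'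
  rw [IsGeodesic, SimpleGraph.Walk.length_append] at h
  have hq := SimpleGraph.dist_le q
  have hr := SimpleGraph.dist_le r
  rw [SimpleGraph.Walk.mem_support_append_iff] at hu
  rcases hu with hu | hu
  · exact IsGeodesic.dist_add hK (γ := q) (by rw [IsGeodesic]; omega) hu
  · have h2 := IsGeodesic.dist_add hK (γ := r) (by rw [IsGeodesic]; omega) hu
    have h3 := hK.dist_triangle a u b
    rw [SimpleGraph.dist_comm (u := u) (v := u')]
    omega

/-- The vertices between two vertices of a geodesic from `a` to `b` lie between `a` and `b`, and
are no closer to `a` and `b`. -/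
theorem IsGeodesic.dist_between {a b u u' w : K.Cube 0} {γ : K.graph.Walk a b}
    (hK : K.IsCATZero) (h : IsGeodesic γ) (hu : u ∈ γ.support) (hu' : u' ∈ γ.support)
    (hw : K.graph.dist u w + K.graph.dist w u' = K.graph.dist u u') {T : ℕ}
    (h1 : T < K.graph.dist a u) (h2 : T < K.graph.dist u b)
    (h3 : T < K.graph.dist a u') (h4 : T < K.graph.dist u' b) :
    K.graph.dist a w + K.graph.dist w b = K.graph.dist a b ∧ T < K.graph.dist a w ∧
      T < K.graph.dist w b := by
  have d1 := h.dist_add hK hu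
  have d2 := h.dist_add hK hu'
  have t1 := hK.dist_triangle a u w
  have t2 := hK.dist_triangle w u' b
  have t3 := hK.dist_triangle a u' w
  have t4 := hK.dist_triangle w u b
  have t5 := hK.dist_triangle a w b
  have c1 := SimpleGraph.dist_comm (G := K.graph) (u := u') (v := w)
  have c2 := SimpleGraph.dist_comm (G := K.graph) (u := w) (v := u)
  have c3 := SimpleGraph.dist_comm (G := K.graph) (u := u') (v := u)
  rcases le_total (K.graph.dist a u) (K.graph.dist a u') with hle | hle
  · have := h.dist_add_of_le hK hu hu' hle
    omega
  · have := h.dist_add_of_le hK hu' hu hle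
    omega

theorem IsGeodesic.exists_middle {a b : K.Cube 0} {γ : K.graph.Walk a b} (hK : K.IsCATZero)
    (h : IsGeodesic γ) {k : ℕ} (hk : 2 * k ≤ γ.length) :
    ∃ (a' b' : K.Cube 0) (γ' : K.graph.Walk a' b'), γ'.IsSubwalk γ ∧
      γ'.length = γ.length - 2 * k ∧
      ∀ v ∈ γ'.support, k ≤ K.graph.dist a v ∧ k ≤ K.graph.dist v b := by
  refine ⟨_, _, (γ.drop k).take (γ.length - 2 * k),
    (SimpleGraph.Walk.isSubwalk_take _ _).trans (SimpleGraph.Walk.isSubwalk_drop _ _), ?_, ?_⟩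
  · rw [SimpleGraph.Walk.take_length, SimpleGraph.Walk.drop_length]
    omega
  · intro v hv
    rw [SimpleGraph.Walk.mem_support_iff_exists_getVert] at hv
    obtain ⟨i, rfl, hi⟩ := hv
    rw [SimpleGraph.Walk.take_length, SimpleGraph.Walk.drop_length] at hi
    rw [SimpleGraph.Walk.take_getVert, SimpleGraph.Walk.drop_getVert]
    have hd := h.dist_add hK (γ.getVert_mem_support (k + min (γ.length - 2 * k) i))
    have h1 := SimpleGraph.dist_le (γ.take (k + min (γ.length - 2 * k) i))
    have h2 := SimpleGraph.dist_le (γ.drop (k + min (γ.length - 2 * k) i))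
    rw [SimpleGraph.Walk.take_length] at h1
    rw [SimpleGraph.Walk.drop_length] at h2
    rw [IsGeodesic] at h
    omega

theorem Subcomplex.IsConvex.mem_side_iff_of_not_crosses {Y : K.Subcomplex} (hY : Y.IsConvex)
    (hK : K.IsCATZero) {e : K.Cube 1} (he : e ∈ Y.cells 1) {a b : K.Cube 0}
    (γ : K.graph.Walk a b) (hγ : ∀ w ∈ γ.support, w ∈ Y.cells 0)
    (hc : ¬ Crosses γ (Y.hyp e)) {w : K.Cube 0} (hw : w ∈ γ.support) :
    a ∈ side e ↔ w ∈ side e := by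
  induction γ with
  | nil =>
    obtain rfl : w = _ := by simpa using hw
    rfl
  | @cons a c b hac γ ih =>
    obtain ⟨-, f, hf, hf'⟩ := id hac
    have hstep : a ∈ side e ↔ c ∈ side e := by
      by_contra hne
      refine hc ⟨⟨(a, c), hac⟩, by simp, f, hY.mem_hyp hK he (hY.edge_mem ?_ ?_) ?_, hf, hf'⟩
      · rw [hf]
        exact hγ _ (by simp)
      · rw [hf']
        exact hγ _ (by simp)
      · rwa [hf, hf']
    rw [SimpleGraph.Walk.support_cons, List.mem_cons] at hw
    rcases hw with rfl | hw
    · rfl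
    · refine hstep.trans (ih (fun w hw => hγ w (by simp [hw])) ?_ hw)
      rintro ⟨d, hd, hd'⟩
      exact hc ⟨d, by simp [hd], hd'⟩

namespace Subcomplex

variable {Y : K.Subcomplex}

/-- The vertices of `Y` that lie in no shallow halfspace of `Y`, except possibly in those that
contain `x`. -/
def core (Y : K.Subcomplex) (x : K.Cube 0) : Set (K.Cube 0) :=
  {z | z ∈ Y.cells 0 ∧ ∀ e ∈ Y.cells 1, ¬ Y.Deep e → x ∉ side e → z ∉ side e}

/-- The vertices of the convex hull of `S` in `Y`: the intersection of all halfspaces of `Y` that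
contain `S`. -/
def hull (Y : K.Subcomplex) (S : Set (K.Cube 0)) : Set (K.Cube 0) :=
  {z | z ∈ Y.cells 0 ∧ ∀ e ∈ Y.cells 1, S ⊆ side e → z ∈ side e}

theorem IsConvex.isConvex_core (hY : Y.IsConvex) (hK : K.IsCATZero) (x : K.Cube 0) :
    (span K (Y.core x)).IsConvex :=
  isConvex_span hK fun _ ha _ hb _ hw => ⟨hY.mem_of_dist hK ha.1 hb.1 hw,
    fun e he hd hx => hY.notMem_side_of_dist hK he ha.1 hb.1 (ha.2 e he hd hx)
      (hb.2 e he hd hx) hw⟩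

theorem IsConvex.isConvex_hull (hY : Y.IsConvex) (hK : K.IsCATZero) (S : Set (K.Cube 0)) :
    (span K (Y.hull S)).IsConvex :=
  isConvex_span hK fun _ ha _ hb _ hw => ⟨hY.mem_of_dist hK ha.1 hb.1 hw,
    fun e he hS => hY.mem_side_of_dist hK he ha.1 hb.1 (ha.2 e he hS) (hb.2 e he hS) hw⟩

theorem subset_hull {S : Set (K.Cube 0)} (hS : S ⊆ Y.cells 0) : S ⊆ Y.hull S :=
  fun _ hs => ⟨hS hs, fun _ _ h => h hs⟩

theorem hull_subset_core (hK : K.IsCATZero) {x : K.Cube 0} {S : Set (K.Cube 0)}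
    (hS : S ⊆ Y.core x) : Y.hull S ⊆ Y.core x := by
  refine fun z hz => ⟨hz.1, fun e he hd hx => ?_⟩
  rw [← Set.mem_compl_iff, ← hK.side_inv]
  refine hz.2 _ (Y.inv_mem he) fun s hs => ?_
  rw [hK.side_inv]
  exact (hS hs).2 e he hd hx

theorem self_mem_core {x : K.Cube 0} (hx : x ∈ Y.cells 0) : x ∈ Y.core x :=
  ⟨hx, fun _ _ _ h => h⟩

theorem span_le (hY : Y.IsConvex) {S : Set (K.Cube 0)} (hS : S ⊆ Y.cells 0) : span K S ≤ Y :=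
  fun n c hc => hY.full n c fun x => hS (hc x)

theorem isConvex_translate (hK : K.IsCATZero) (hY : Y.IsConvex) (g : K.Aut) :
    (Y.translate g).IsConvex := by
  have : Y.translate g = span K {v | g⁻¹ • v ∈ Y.cells 0} := by
    ext n c
    rw [mem_translate, hY.mem_iff, mem_span]
    simp only [Set.mem_ofPred_eq, smul_vertex]
  rw [this]
  refine isConvex_span hK fun a ha b hb w hw => ?_
  refine hY.mem_of_dist hK ha hb ?_
  rw [hK.dist_smul, hK.dist_smul, hK.dist_smul, hw]

theorem mem_iUnion {ι : Type*} {Z : ι → K.Subcomplex} {n : ℕ} {c : K.Cube n} :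
    c ∈ (iUnion Z).cells n ↔ ∃ i, c ∈ (Z i).cells n := Set.mem_iUnion

end Subcomplex

namespace IsLine

variable {Y : K.Subcomplex} {φ : K.Aut}

/-! ### The core of a line -/

/-- Every cube of `Y` has a translate within a uniform distance of any given vertex of `Y`. -/
theorem exists_dist_le_uniform (h : IsLine Y φ) : ∃ R : ℕ, ∀ x ∈ Y.cells 0, ∀ (n : ℕ),
    ∀ c ∈ Y.cells n, ∃ k : ℤ, ∀ v, K.graph.dist x (K.vertex (φ ^ k • c) v) ≤ R := by
  rcases (Y.cells 0).eq_empty_or_nonempty with hY | ⟨y₀, hy₀⟩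
  · exact ⟨0, by simp [hY]⟩
  obtain ⟨R, hR⟩ := h.exists_dist_le y₀
  obtain ⟨R', hR'⟩ := h.exists_dist_le_zero y₀
  refine ⟨R' + R, fun x hx n c hc => ?_⟩
  obtain ⟨k, hk⟩ := hR n c hc
  obtain ⟨i, hi⟩ := hR' x hx
  refine ⟨i + k, fun v => ?_⟩
  have h1 := h.catZero.dist_triangle x (φ ^ i • y₀) (K.vertex (φ ^ (i + k) • c) v)
  have h2 := hk v
  rw [zpow_add, mul_smul, ← smul_vertex, h.dist_zpow,
    SimpleGraph.dist_comm (u := x) (v := φ ^ i • y₀)] at h1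
  rw [zpow_add, mul_smul, ← smul_vertex]
  omega

/-- A version of `IsLine.exists_between` that is uniform in the base point. -/
theorem exists_between_uniform (h : IsLine Y φ) (r : ℕ) : ∃ R : ℕ, ∀ x ∈ Y.cells 0,
    ∀ u ∈ Y.cells 0, ∀ u' ∈ Y.cells 0, ∀ i t j : ℤ, i ≤ t → t ≤ j →
    K.graph.dist (φ ^ i • x) u ≤ r → K.graph.dist (φ ^ j • x) u' ≤ r → ∃ w ∈ Y.cells 0,
      K.graph.dist u w + K.graph.dist w u' = K.graph.dist u u' ∧
      K.graph.dist w (φ ^ t • x) ≤ R := by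
  rcases (Y.cells 0).eq_empty_or_nonempty with hY | ⟨y₀, hy₀⟩
  · exact ⟨0, by simp [hY]⟩
  obtain ⟨R', hR'⟩ := h.exists_dist_le_zero y₀
  obtain ⟨R, hR⟩ := h.exists_between y₀ (R' + r)
  refine ⟨R + R', fun x hx u hu u' hu' i t j hit htj hi hj => ?_⟩
  obtain ⟨s, hs⟩ := hR' x hx
  have key : ∀ k : ℤ, K.graph.dist (φ ^ (k + s) • y₀) (φ ^ k • x) ≤ R' := by
    intro k
    rwa [zpow_add, mul_smul, h.dist_zpow]
  have t1 := h.catZero.dist_triangle (φ ^ (i + s) • y₀) (φ ^ i • x) u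
  have t2 := h.catZero.dist_triangle (φ ^ (j + s) • y₀) (φ ^ j • x) u'
  have k1 := key i
  have k2 := key j
  obtain ⟨w, hw, hw', hwt⟩ := hR u hu u' hu' (i + s) (t + s) (j + s) (by omega) (by omega)
    (by omega) (by omega)
  refine ⟨w, hw, hw', ?_⟩
  have t3 := h.catZero.dist_triangle w (φ ^ (t + s) • y₀) (φ ^ t • x)
  have k3 := key t
  omega

/-- A vertex in the middle of a long geodesic of `Y` lies in no bounded halfspace, since such a
halfspace would contain an endpoint of the geodesic. -/
theorem exists_notMem_side (h : IsLine Y φ) : ∃ T : ℕ, ∀ a ∈ Y.cells 0, ∀ t ∈ Y.cells 0,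
    ∀ b ∈ Y.cells 0, K.graph.dist a t + K.graph.dist t b = K.graph.dist a b →
    T < K.graph.dist a t → T < K.graph.dist t b →
    ∀ e ∈ Y.cells 1, ¬ Periodic φ e → ¬ Y.Deep e → t ∉ side e := by
  obtain ⟨R, hR⟩ := h.exists_half_le
  refine ⟨2 * R, fun a ha t ht b hb hd h1 h2 e he hp hdeep hte => ?_⟩
  have h3 := hR e he hp hdeep t ⟨ht, hte⟩
  have key : ∀ c ∈ Y.cells 0, c ∈ side e → K.graph.dist c t ≤ 2 * R := by
    intro c hc hce
    have h4 := hR e he hp hdeep c ⟨hc, hce⟩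
    have h5 := h.catZero.dist_triangle c (K.src e) t
    rw [SimpleGraph.dist_comm (u := K.src e)] at h5
    omega
  refine h.convex.notMem_side_of_dist h.catZero he ha hb ?_ ?_ hd hte
  · intro hae
    have := key a ha hae
    omega
  · intro hbe
    have := key b hb hbe
    rw [SimpleGraph.dist_comm] at this
    omega

theorem smul_mem_core (h : IsLine Y φ)
    (hφ : ∀ e ∈ Y.cells 1, Periodic φ e → φ ∈ sideStabilizer e) {x : K.Cube 0}
    (hx : ∀ e ∈ Y.cells 1, ¬ Periodic φ e → ¬ Y.Deep e → x ∉ side e) (k : ℤ) {z : K.Cube 0} :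
    φ ^ k • z ∈ Y.core x ↔ z ∈ Y.core x := by
  have key : ∀ (k : ℤ) (z : K.Cube 0), z ∈ Y.core x → φ ^ k • z ∈ Y.core x := by
    intro k z hz
    refine ⟨(h.zpow_mem k 0 z).2 hz.1, fun e he hd hxe => ?_⟩
    by_cases hp : Periodic φ e
    · rw [Subgroup.zpow_mem _ (hφ e he hp) k]
      exact hz.2 e he hd hxe
    · rw [h.catZero.smul_mem_side', ← zpow_neg]
      have he' := (h.zpow_mem (-k) 1 e).2 he
      have hd' : ¬ Y.Deep (φ ^ (-k) • e) := by rwa [deep_smul h.catZero (h.zpow_mem _)]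
      exact hz.2 _ he' hd' (hx _ he' (by rwa [h.periodic_zpow_smul]) hd')
  refine ⟨fun hz => ?_, key k z⟩
  have := key (-k) _ hz
  rwa [zpow_neg, inv_smul_smul] at this

/-- A vertex of the core that is close to the middle of a long geodesic of a convex subcomplex `W`
lies in `W`. Otherwise a hyperplane separates it from `W`. The halfspace that does not meet `W` is
deep by the definition of the core, so it contains one end of `Y`, and with it an endpoint of the
geodesic. -/
theorem exists_mem_of_mem_core (h : IsLine Y φ) (ρ : ℕ) : ∃ T : ℕ, ∀ W : K.Subcomplex,
    W.IsConvex → W ≤ Y → ∀ a ∈ W.cells 0, ∀ b ∈ W.cells 0, ∀ x ∈ W.cells 0, ∀ t,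
    K.graph.dist a t + K.graph.dist t b = K.graph.dist a b →
    T < K.graph.dist a t → T < K.graph.dist t b →
    ∀ z ∈ Y.core x, K.graph.dist z t ≤ ρ → z ∈ W.cells 0 := by
  obtain ⟨T, hT⟩ := h.exists_mem_side ρ
  refine ⟨T, fun W hW hWY a ha b hb x hx t hd h1 h2 z hz hzt => ?_⟩
  by_contra hzW
  have ht := hW.mem_of_dist h.catZero ha hb hd
  obtain ⟨e, he, hze, hWe⟩ := h.convex.exists_separating h.catZero hW hWY ⟨a, ha⟩ hz.1 hzW
  have hdeep : Y.Deep e := by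
    by_contra hdeep
    exact hz.2 e he hdeep (hWe x hx) hze
  have hp : ¬ Periodic φ e := fun hp => h.not_deep_of_periodic he hp hdeep
  obtain ⟨f, hf, hf1, hf2, hfd⟩ := h.convex.exists_edge_of_mem_of_notMem h.catZero hz.1
    (hWY 0 ht) hze (hWe t ht)
  have hft : K.graph.dist t (K.src f) ≤ ρ := by
    have := h.catZero.dist_triangle (K.src f) (K.tgt f) t
    rw [h.catZero.dist_src_tgt] at this
    rw [SimpleGraph.dist_comm]
    omega
  rcases hT e he hp hdeep a (hWY 0 ha) t (hWY 0 ht) b (hWY 0 hb)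
    ⟨f, (h.convex.mem_hyp_of_src_mem h.catZero he hf hf1 hf2).1, hft⟩ hd h1 h2 with hae | hbe
  · exact hWe a ha hae
  · exact hWe b hb hbe

/-- The convex hull of a bounded part of the core is bounded, since the hyperplanes that cross the
core have bounded diameter. -/
theorem exists_hull_le (h : IsLine Y φ) (r : ℕ) : ∃ R : ℕ, ∀ x ∈ Y.cells 0,
    ∀ z ∈ Y.hull {s | s ∈ Y.core x ∧ K.graph.dist x s ≤ r}, K.graph.dist x z ≤ R := by
  obtain ⟨D, hD⟩ := h.exists_hyp_diam_le
  refine ⟨r + 2 * D + 1, fun x hx z hz => ?_⟩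
  have hzc := hull_subset_core h.catZero (fun s hs => hs.1) hz
  by_cases hzx : z = x
  · rw [hzx, SimpleGraph.dist_self]
    omega
  obtain ⟨f, hfz, hf⟩ := h.catZero.exists_first_edge hzx
  -- The last edge of a geodesic from `x` to `z`.
  set e := K.inv f with he_def
  have hsrc : K.src e = K.tgt f := K.src_inv f
  have htgt : K.tgt e = z := by rw [he_def, K.tgt_inv, hfz]
  have hfY : K.tgt f ∈ Y.cells 0 := h.convex.mem_of_dist h.catZero hz.1 hx (by
    rw [← hfz, h.catZero.dist_src_tgt, hfz]
    omega)
  have he : e ∈ Y.cells 1 := h.convex.edge_mem (hsrc ▸ hfY) (htgt ▸ hz.1)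
  have hxe : x ∈ side e := by
    rw [h.catZero.mem_side, hsrc, htgt, SimpleGraph.dist_comm, ← hf, SimpleGraph.dist_comm]
  have hze : z ∉ side e := htgt ▸ h.catZero.tgt_notMem_side e
  have hp : ¬ Periodic φ e := by
    intro hp
    refine hzc.2 (K.inv e) (Y.inv_mem he)
      (h.not_deep_of_periodic (Y.inv_mem he) (h.periodic_inv.2 hp)) ?_ ?_
    · rw [h.catZero.side_inv]
      exact fun hx' => hx' hxe
    · rwa [h.catZero.side_inv]
  obtain ⟨s, hs, hse⟩ : ∃ s ∈ {s | s ∈ Y.core x ∧ K.graph.dist x s ≤ r}, s ∉ side e := by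
    by_contra hcon
    push Not at hcon
    exact hze (hz.2 e he hcon)
  obtain ⟨g, hg, hg1, hg2, hgd⟩ :=
    h.convex.exists_edge_of_mem_of_notMem h.catZero hx hs.1.1 hxe hse
  have h1 := hD e he hp g (h.convex.mem_hyp_of_src_mem h.catZero he hg hg1 hg2).1
  have h2 := hs.2
  have h3 := h.catZero.dist_triangle x (K.src e) z
  have h4 := h.catZero.dist_triangle x (K.src g) (K.src e)
  have h5 := h.catZero.dist_src_tgt e
  rw [htgt] at h5
  rw [SimpleGraph.dist_comm (u := K.src g)] at h4
  omega

/-! ### Translates of a bounded convex subcomplex -/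

theorem pow (h : IsLine Y φ) {n : ℕ} (hn : 0 < n) : IsLine Y (φ ^ n) where
  catZero := h.catZero
  finite_ball := h.finite_ball
  convex := h.convex
  mem_stabilizer := Y.stabilizer.pow_mem h.mem_stabilizer n
  free k v hk := by
    rw [← zpow_natCast, ← zpow_mul] at hk
    have := h.free _ v hk
    rw [mul_eq_zero] at this
    omega
  cocompact := by
    obtain ⟨F, hF, hcov⟩ := h.cocompact
    refine ⟨⋃ r ∈ Finset.range n, (fun s => ⟨s.1, φ ^ (-(r : ℤ)) • s.2⟩) '' F,
      (Finset.range n).finite_toSet.biUnion fun r _ => hF.image _, fun m c hc => ?_⟩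
    obtain ⟨k, hk⟩ := hcov m c hc
    refine ⟨k / n, ?_⟩
    have h1 := Int.emod_nonneg k (b := n) (by omega)
    have h2 := Int.emod_lt_of_pos k (b := n) (by omega)
    simp only [Set.mem_iUnion]
    refine ⟨(k % n).toNat, by rw [Finset.mem_range]; omega, _, hk, ?_⟩
    have : φ ^ (-((k % n).toNat : ℤ)) • φ ^ k • c = (φ ^ n) ^ (k / (n : ℤ)) • c := by
      rw [← mul_smul, ← zpow_add, ← zpow_natCast, ← zpow_mul, Int.toNat_of_nonneg h1,
        Int.emod_def]
      congr 2
      ring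
    exact congrArg (Sigma.mk m) this

/-- The core `Z` is covered by the translates of the hull of a large ball of the core. The
subcomplex `C` is the first of these translates that meets the middle part of the geodesic. -/
theorem exists_translates (h : IsLine Y φ)
    (hφ : ∀ e ∈ Y.cells 1, Periodic φ e → φ ∈ sideStabilizer e) :
    ∃ T : ℕ, ∀ W : K.Subcomplex, W.IsConvex → W ≤ Y →
      ∀ (a b : K.Cube 0) (γ : K.graph.Walk a b), IsGeodesic γ → W.ContainsPath γ →
      (∀ H, Y.IsTrivialHyperplane H → ¬ Crosses γ H) → 2 * (T + 1) ≤ γ.length →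
      ∃ (Z C : K.Subcomplex) (l : ℕ), Z.IsConvex ∧ (Z.cells 0).Nonempty ∧ Z ≤ Y ∧
        φ ∈ Z.stabilizer ∧ C.IsConvex ∧ C ≤ Y ∧
        iUnion (fun k : ℤ => C.translate (φ ^ k)) = Z ∧
        (∃ (a' b' : K.Cube 0) (γ' : K.graph.Walk a' b'), γ'.IsSubwalk γ ∧
          γ'.length = γ.length - 2 * (T + 1) ∧
          (iUnion fun k : Fin (l + 1) => C.translate (φ ^ (k : ℕ))).ContainsPath γ') ∧
        (iUnion fun k : Fin (l + 1) => C.translate (φ ^ (k : ℕ))) ≤ W := by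
  have hK := h.catZero
  obtain ⟨R, hR⟩ := h.exists_dist_le_uniform
  obtain ⟨R₁, hR₁⟩ := h.exists_hull_le R
  obtain ⟨R₂, hR₂⟩ := h.exists_between_uniform R₁
  obtain ⟨T₁, hT₁⟩ := h.exists_notMem_side
  obtain ⟨T₂, hT₂⟩ := h.exists_mem_of_mem_core (R₁ + R₂)
  refine ⟨T₁ + T₂, ?_⟩
  intro W hW hWY a b γ hγ hγW hc hlen
  obtain ⟨x, b', γ', hsub, hlen', hmid⟩ := hγ.exists_middle hK hlen
  have haW : a ∈ W.cells 0 := hγW.1 _ γ.start_mem_support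
  have hbW : b ∈ W.cells 0 := hγW.1 _ γ.end_mem_support
  have hγ'W : ∀ w ∈ γ'.support, w ∈ W.cells 0 :=
    fun w hw => hγW.1 w (hsub.support_subset hw)
  have hxW : x ∈ W.cells 0 := hγ'W _ γ'.start_mem_support
  have hxY := hWY 0 hxW
  -- Vertices of the middle part lie in no bounded halfspace.
  have hmid' : ∀ w ∈ γ'.support, ∀ e ∈ Y.cells 1, ¬ Periodic φ e → ¬ Y.Deep e →
      w ∉ side e := by
    intro w hw
    have := hmid w hw
    exact hT₁ a (hWY 0 haW) w (hWY 0 (hγ'W w hw)) b (hWY 0 hbW)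
      (hγ.dist_add hK (hsub.support_subset hw)) (by omega) (by omega)
  have hx := hmid' x γ'.start_mem_support
  have hcore : ∀ w ∈ γ'.support, w ∈ Y.core x := by
    refine fun w hw => ⟨hWY 0 (hγ'W w hw), fun e he hd hxe => ?_⟩
    by_cases hp : Periodic φ e
    · have key := fun u (hu : u ∈ γ'.support) =>
        h.convex.mem_side_iff_of_not_crosses hK he γ (fun w hw => hWY 0 (hγW.1 w hw))
          (hc _ (h.isTrivialHyperplane_of_periodic he hp)) (hsub.support_subset hu)
      rwa [← key w hw, key x γ'.start_mem_support]
    · exact hmid' w hw e he hp hd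
  -- The hull of a ball of the core.
  set S : Set (K.Cube 0) := {s | s ∈ Y.core x ∧ K.graph.dist x s ≤ R} with hS
  have hSY : S ⊆ Y.cells 0 := fun s hs => hs.1.1
  set D : K.Subcomplex := span K (Y.hull S) with hD
  have hDcore : ∀ {z}, z ∈ D.cells 0 → z ∈ Y.core x :=
    fun hz => hull_subset_core hK (fun s hs => hs.1) (mem_span_zero.1 hz)
  have hDx : ∀ {z} (k : ℤ), φ ^ k • z ∈ D.cells 0 →
      K.graph.dist (φ ^ (-k) • x) z ≤ R₁ := by
    intro z k hz
    rw [← h.dist_zpow k, zpow_neg, smul_inv_smul]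
    exact hR₁ x hxY _ (mem_span_zero.1 hz)
  have hcov : ∀ (n : ℕ), ∀ c ∈ (span K (Y.core x)).cells n, ∃ k : ℤ, φ ^ k • c ∈ D.cells n := by
    intro n c hc
    obtain ⟨k, hk⟩ := hR x hxY n c (span_le h.convex (fun z hz => hz.1) n hc)
    refine ⟨k, fun v => subset_hull hSY ⟨?_, hk v⟩⟩
    rw [← smul_vertex, h.smul_mem_core hφ hx]
    exact hc v
  -- The translates of `D` that meet the middle part.
  set J : Set ℤ := {k | ∃ w ∈ γ'.support, φ ^ (-k) • w ∈ D.cells 0} with hJ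
  have hJfin : J.Finite := by
    have : J ⊆ ⋃ w ∈ γ'.support, {k : ℤ | φ ^ (-k) • w ∈ {v | K.graph.dist x v ≤ R₁}} := by
      rintro k ⟨w, hw, hk⟩
      refine Set.mem_biUnion hw ?_
      exact hR₁ x hxY _ (mem_span_zero.1 hk)
    refine Set.Finite.subset (Set.Finite.biUnion (List.finite_toSet γ'.support) fun w _ => ?_) this
    exact (h.finite_ball x R₁).preimage
      ((h.zpow_smul_injective w).comp neg_injective).injOn
  have hJne : J.Nonempty := by
    obtain ⟨k, hk⟩ := hcov 0 x (mem_span_zero.2 (self_mem_core hxY))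
    exact ⟨-k, x, γ'.start_mem_support, by rwa [neg_neg]⟩
  obtain ⟨i, ⟨u, hu, hui⟩, hmin⟩ := Set.exists_min_image J id hJfin hJne
  obtain ⟨j, ⟨u', hu', huj⟩, hmax⟩ := Set.exists_max_image J id hJfin hJne
  have hij : i ≤ j := hmin j ⟨u', hu', huj⟩
  have hmem : ∀ (k : ℤ) (n : ℕ) (c : K.Cube n),
      c ∈ ((D.translate (φ ^ i)).translate (φ ^ k)).cells n ↔ φ ^ (-(i + k)) • c ∈ D.cells n := by
    intro k n c
    rw [mem_translate, mem_translate, ← mul_smul, ← mul_inv_rev, ← zpow_add, zpow_neg, add_comm k]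
  have hmemNat : ∀ (k : ℕ) (n : ℕ) (c : K.Cube n),
      c ∈ ((D.translate (φ ^ i)).translate (φ ^ k)).cells n ↔
        φ ^ (-(i + (k : ℤ))) • c ∈ D.cells n := by
    intro k n c
    rw [← hmem k, zpow_natCast]
  have hDconv : D.IsConvex := h.convex.isConvex_hull hK S
  have hsmul : ∀ (k : ℤ) (n : ℕ) (c : K.Cube n), φ ^ k • c ∈ (span K (Y.core x)).cells n ↔
      c ∈ (span K (Y.core x)).cells n := by
    intro k n c
    simp only [mem_span, ← smul_vertex, h.smul_mem_core hφ hx]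
  have hDle : ∀ n, D.cells n ⊆ (span K (Y.core x)).cells n :=
    fun n c hc v => hull_subset_core hK (fun s hs => hs.1) (hc v)
  refine ⟨span K (Y.core x), D.translate (φ ^ i), (j - i).toNat,
    h.convex.isConvex_core hK x, ⟨x, mem_span_zero.2 (self_mem_core hxY)⟩,
    span_le h.convex fun z hz => hz.1, ?_, isConvex_translate hK hDconv _, ?_, ?_,
    ⟨x, b', γ', hsub, hlen', ?_, ?_⟩, ?_⟩
  · intro n c
    rw [← hsmul 1 n c, zpow_one]
  · intro n c hc
    rw [mem_translate, ← zpow_neg] at hc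
    exact (h.zpow_mem _ n c).1 (span_le h.convex (fun z hz => hz.1) n hc)
  · ext n c
    rw [mem_iUnion]
    constructor
    · rintro ⟨k, hk⟩
      rw [hmem] at hk
      exact (hsmul _ n c).1 (hDle n hk)
    · intro hc
      obtain ⟨k, hk⟩ := hcov n c hc
      refine ⟨-k - i, (hmem _ n c).2 ?_⟩
      rwa [show -(i + (-k - i)) = k by ring]
  · intro w hw
    obtain ⟨k, hk⟩ := hcov 0 w (mem_span_zero.2 (hcore w hw))
    have hkJ : -k ∈ J := ⟨w, hw, by rwa [neg_neg]⟩
    have h1 : i ≤ -k := hmin _ hkJ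
    have h2 : -k ≤ j := hmax _ hkJ
    refine mem_iUnion.2 ⟨⟨(-k - i).toNat, by omega⟩, (hmemNat _ _ _).2 ?_⟩
    rwa [Int.toNat_of_nonneg (by omega), show -(i + (-k - i)) = k by ring]
  · intro d hd e hd1 hd2
    have he : e ∈ (span K (Y.core x)).cells 1 := by
      refine forall_vertex_edge (P := (· ∈ Y.core x)) ?_ ?_
      · rw [hd1]
        exact hcore _ (γ'.dart_fst_mem_support_of_mem_darts hd)
      · rw [hd2]
        exact hcore _ (γ'.dart_snd_mem_support_of_mem_darts hd)
    obtain ⟨k, hk⟩ := hcov 1 e he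
    have hkJ : -k ∈ J := by
      refine ⟨_, γ'.dart_fst_mem_support_of_mem_darts hd, ?_⟩
      rw [neg_neg, ← hd1, ← src_smul]
      exact D.src_mem hk
    have h1 : i ≤ -k := hmin _ hkJ
    have h2 : -k ≤ j := hmax _ hkJ
    refine mem_iUnion.2 ⟨⟨(-k - i).toNat, by omega⟩, (hmemNat _ _ _).2 ?_⟩
    rwa [Int.toNat_of_nonneg (by omega), show -(i + (-k - i)) = k by ring]
  · intro n c hc
    obtain ⟨⟨k, hk⟩, hck⟩ := mem_iUnion.1 hc
    rw [hmemNat] at hck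
    -- The translate contains points close to the middle part, and lies in the core.
    obtain ⟨w, -, hw, hwk⟩ := hR₂ x hxY u (hWY 0 (hγ'W u hu)) u' (hWY 0 (hγ'W u' hu'))
      i (i + k) j (by omega) (by omega) (by simpa using hDx _ hui) (by simpa using hDx _ huj)
    have hmu := hmid u hu
    have hmu' := hmid u' hu'
    obtain ⟨hw1, hw2, hw3⟩ := hγ.dist_between hK (hsub.support_subset hu)
      (hsub.support_subset hu') hw (T := T₁ + T₂) (by omega) (by omega) (by omega) (by omega)
    refine hW.full n c fun v => ?_
    have hv : φ ^ (-(i + (k : ℤ))) • K.vertex c v ∈ D.cells 0 := by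
      rw [smul_vertex]
      exact D.vertex_mem hck v
    refine hT₂ W hW hWY a haW b hbW x hxW w hw1 (by omega) (by omega) _
      ((h.smul_mem_core hφ hx _).1 (hDcore hv)) ?_
    have h1 := hDx _ hv
    have h2 := hK.dist_triangle (K.vertex c v) (φ ^ (i + (k : ℤ)) • x) w
    rw [neg_neg] at h1
    rw [SimpleGraph.dist_comm (u := K.vertex c v) (v := φ ^ (i + (k : ℤ)) • x),
      SimpleGraph.dist_comm (u := φ ^ (i + (k : ℤ)) • x) (v := w)] at h2
    omega

end IsLine

end CubeComplex

open CubeComplex CubeComplex.Subcomplex in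
theorem mainTheorem4 (X : CubeComplex.{u}) (hXc : X.IsCompact) (hX : X.IsNonpositivelyCurved)
    (Xt : CubeComplex.{v}) (p : CubeComplex.Hom Xt X) (hp : p.IsUniversalCover)
    (Y : Xt.Subcomplex) (φ : Xt.Aut) (hY : CubeComplex.IsQuasiline p Y φ) :
    ∃ (B₀ : ℝ) (n : ℕ), 0 < n ∧ ∀ B : ℝ, B₀ ≤ B →
      ∀ W : Xt.Subcomplex, W.IsConvex → W ≤ Y →
      ∀ (a b : Xt.Cube 0) (γ : Xt.graph.Walk a b), CubeComplex.IsGeodesic γ → W.ContainsPath γ →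
      (∀ H, Y.IsTrivialHyperplane H → ¬ CubeComplex.Crosses γ H) →
      3 * B ≤ (γ.length : ℝ) →
      ∃ (C : Xt.Subcomplex) (l : ℕ), C.IsConvex ∧ C ≤ Y ∧
        (∃ (a' b' : Xt.Cube 0) (γ' : Xt.graph.Walk a' b'), γ'.IsSubwalk γ ∧
          B < (γ'.length : ℝ) ∧
          (CubeComplex.Subcomplex.iUnion
            (fun k : Fin (l + 1) => C.translate (φ ^ (n * (k : ℕ))))).ContainsPath γ') ∧
        CubeComplex.Subcomplex.iUnion
            (fun k : Fin (l + 1) => C.translate (φ ^ (n * (k : ℕ)))) ≤ W ∧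
        CubeComplex.IsQuasiline p
          (CubeComplex.Subcomplex.iUnion
            (fun k : ℤ => C.translate (φ ^ ((n : ℤ) * k)))) (φ ^ n) := by
  have hK : Xt.IsCATZero := ⟨hp.1.isNonpositivelyCurved hX, hp.2⟩
  obtain ⟨hstab, F, hF, hcov⟩ := hY.cocompact
  have hφY : φ ∈ Y.stabilizer :=
    mem_stabilizer_of_translate_eq (hstab φ (Subgroup.mem_zpowers φ))
  by_cases hfin : IsOfFinOrder φ
  · -- If `φ` has finite order, then `Y` is finite and contains no long geodesics.
    have hz : Finite (Subgroup.zpowers φ) := hfin.finite_zpowers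
    have hYfin : (Y.cells 0).Finite := by
      have : Y.cells 0 ⊆ ⋃ g ∈ (Subgroup.zpowers φ : Set Xt.Aut),
          {v : Xt.Cube 0 | (⟨0, g • v⟩ : Σ n, Xt.Cube n) ∈ F} := by
        intro v hv
        obtain ⟨g, hg, hgF⟩ := hcov 0 v hv
        exact Set.mem_biUnion hg hgF
      refine Set.Finite.subset (Set.Finite.biUnion (Set.toFinite _) fun g _ => ?_) this
      refine hF.preimage (f := fun v : Xt.Cube 0 => (⟨0, g • v⟩ : Σ n, Xt.Cube n)) ?_
      exact ((sigma_mk_injective (i := 0)).comp (MulAction.injective g)).injOn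
    obtain ⟨N, hN⟩ := ((hYfin.prod hYfin).image
      fun q : Xt.Cube 0 × Xt.Cube 0 => Xt.graph.dist q.1 q.2).bddAbove
    refine ⟨N + 1, 1, one_pos, ?_⟩
    intro B hB W hW hWY a b γ hγ hγW _ hlen
    have : γ.length ≤ N := by
      rw [hγ]
      exact hN ⟨(a, b), ⟨hWY 0 (hγW.1 a γ.start_mem_support),
        hWY 0 (hγW.1 b γ.end_mem_support)⟩, rfl⟩
    have : (γ.length : ℝ) ≤ N := by exact_mod_cast this
    have : (0 : ℝ) ≤ N := N.cast_nonneg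
    linarith
  have hfree : ∀ (k : ℤ) (v : Xt.Cube 0), φ ^ k • v = v → k = 0 := by
    intro k v hkv
    have h1 := hp.1.eq_one_of_smul_eq hp.2.1 (p.deck.zpow_mem hY.mem_deck k) hkv
    by_contra hk
    exact hfin (isOfFinOrder_iff_zpow_eq_one.2 ⟨k, hk, h1⟩)
  have hline : IsLine Y φ := {
    catZero := hK
    finite_ball := hp.1.finite_ball hXc hK
    convex := hY.convex
    mem_stabilizer := hφY
    free := hfree
    cocompact := by
      refine ⟨F, hF, fun n c hc => ?_⟩
      obtain ⟨_, ⟨k, rfl⟩, hg⟩ := hcov n c hc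
      exact ⟨k, hg⟩ }
  obtain ⟨n, hn, hper⟩ := hline.exists_pow_mem_sideStabilizer
  have hline' := hline.pow hn
  obtain ⟨T, hT⟩ := hline'.exists_translates (by
    rintro e he ⟨k, hk, hke⟩
    exact hper e he ⟨n * k, Nat.mul_pos hn hk, by rwa [pow_mul]⟩)
  refine ⟨2 * (T + 1) + 1, n, hn, ?_⟩
  intro B hB W hW hWY a b γ hγ hγW hc hlen
  have hT0 : (0 : ℝ) ≤ T := T.cast_nonneg
  have hlen' : 2 * (T + 1) ≤ γ.length := by
    have : ((2 * (T + 1) : ℕ) : ℝ) ≤ γ.length := by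
      push_cast
      linarith
    exact_mod_cast this
  obtain ⟨Z, C, l, hZ, hZne, hZY, hZφ, hC, hCY, hCZ, ⟨a', b', γ', hsub, hγ', hcont⟩, hle⟩ :=
    hT W hW hWY a b γ hγ hγW hc hlen'
  simp only [pow_mul, zpow_mul, zpow_natCast]
  refine ⟨C, l, hC, hCY, ⟨a', b', γ', hsub, ?_, hcont⟩, hle, ?_⟩
  · rw [hγ', Nat.cast_sub hlen']
    push_cast
    linarith
  · rw [hCZ]
    refine ⟨p.deck.pow_mem hY.mem_deck n, ?_, hZne, hZ, ?_, ?_⟩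
    · intro h1
      obtain ⟨v, -⟩ := hZne
      have := hline'.free 1 v (by rw [zpow_one, h1, one_smul])
      omega
    · intro g hg
      exact translate_eq (by
        obtain ⟨k, rfl⟩ := hg
        exact Z.stabilizer.zpow_mem hZφ k)
    · obtain ⟨F', hF', hcov'⟩ := hline'.cocompact
      refine ⟨F', hF', fun m c hc => ?_⟩
      obtain ⟨k, hk⟩ := hcov' m c (hZY m hc)
      exact ⟨_, ⟨k, rfl⟩, hk⟩
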